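/- Let $d\ge 1$ and let $M$ be a (simple, locally finite) point process on $\mathbb{R}^d$, with set of points $[M]$, whose law is invariant under all isometries of $\mathbb{R}^d$, which has finite intensity (the expected number of points in every bounded Borel set is finite), and which allows an index function: there is a measurable map $(S,x)\mapsto\iota(S,x)\in\mathbb{R}$, where $S$ is a locally finite configuration and $x\in S$, such that $\iota(\gamma S,\gamma x)=\iota(S,x)$ for every isometry $\gamma$ of $\mathbb{R}^d$, and such that almost surely $x\mapsto\iota([M],x)$ is injective on $[M]$. Then there is an isometry-equivariant clumping, that is, a sequence $(\mathcal{P}_i)_{i\ge 0}$ of maps assigning to each locally finite configuration $S\subset\mathbb{R}^d$ a partition $\mathcal{P}_i(S)$ of $S$ (whose classes are called clumps), such that each $\mathcal{P}_i$ is measurable (the set of triples $(S,x,y)$ with $x,y$ in the same clump of $\mathcal{P}_i(S)$ is measurable), $\mathcal{P}_i(\gamma S)=\gamma\mathcal{P}_i(S)$ for every isometry $\gamma$, and $\mathcal{P}_{i+1}(S)$ is coarser than or equal to $\mathcal{P}_i(S)$, with the following properties, almost surely: 1. (connectedness) any two points of $[M]$ lie in the same clump of $\mathcal{P}_i([M])$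 for some $i$; 2. for each $i\ge 0$, every clump of $\mathcal{P}_i([M])$ has exactly $2^i$ points. -/

import Mathlib

open MeasureTheory
open scoped ENNReal

/-- The Euclidean space `ℝ^d`. -/
abbrev Eucl (d : ℕ) : Type := EuclideanSpace ℝ (Fin d)

/-- A (simple) point configuration in `ℝ^d`: a set of points that has finitely many
points in every bounded set. -/
@[ext]
structure Config (d : ℕ) where
  points : Set (Eucl d)
  locallyFinite : ∀ B : Set (Eucl d), Bornology.IsBounded B → (points ∩ B).Finite

namespace Config

variable {d : ℕ}

/-- The number of points of the configuration in the set `B`. -/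
noncomputable def count (B : Set (Eucl d)) (S : Config d) : ℕ∞ := (S.points ∩ B).encard

/-- The usual σ-algebra on configurations: the smallest one for which the number of points in
each Borel set is measurable. -/
noncomputable instance : MeasurableSpace (Config d) :=
  ⨆ (B : Set (Eucl d)) (_ : MeasurableSet B), MeasurableSpace.comap (count B) inferInstance

/-- The image of a configuration under an isometry of `ℝ^d`. -/
noncomputable def map (γ : Eucl d ≃ᵢ Eucl d) (S : Config d) : Config d where
  points := γ '' S.points
  locallyFinite B hB := by
    have h : (S.points ∩ γ ⁻¹' B).Finite :=
      S.locallyFinite _ (γ.isometry.antilipschitz.isBounded_preimage hB)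
    refine (h.image γ).subset ?_
    rintro _ ⟨⟨x, hx, rfl⟩, hxB⟩
    exact ⟨x, ⟨hx, hxB⟩, rfl⟩

/-- An isometry moves the points of `S` to the points of the image of `S`. -/
noncomputable def move (γ : Eucl d ≃ᵢ Eucl d) (S : Config d) (x : S.points) : (S.map γ).points :=
  ⟨γ x, Set.mem_image_of_mem γ x.2⟩

end Config

/-- The law `μ` of a point process is invariant under all isometries of `ℝ^d`. -/
def IsometryInvariant {d : ℕ} (μ : Measure (Config d)) : Prop :=
  ∀ γ : Eucl d ≃ᵢ Eucl d, MeasurePreserving (Config.map γ) μ μ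

/-- The expected number of points in each bounded Borel set is finite. -/
def FiniteIntensity {d : ℕ} (μ : Measure (Config d)) : Prop :=
  ∀ B : Set (Eucl d), MeasurableSet B → Bornology.IsBounded B →
    ∫⁻ S, (Config.count B S : ℝ≥0∞) ∂μ < ∞

/-- The point process with law `μ` allows an index function: one can assign real numbers to the
points of a configuration, in a measurable and isometry-equivariant way, so that almost surely
distinct points get distinct numbers. (The values of `ι S` off the points of `S` play no role.) -/
def AllowsIndexFunction {d : ℕ} (μ : Measure (Config d)) : Prop :=
  ∃ ι : Config d → Eucl d → ℝ,
    Measurable (fun p : Config d × Eucl d => ι p.1 p.2) ∧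
    (∀ (γ : Eucl d ≃ᵢ Eucl d) (S : Config d), ∀ x ∈ S.points, ι (S.map γ) (γ x) = ι S x) ∧
    ∀ᵐ S ∂μ, Set.InjOn (ι S) S.points

/-- An equivariant clumping: a sequence of coarser and coarser partitions of the point set
(given by equivalence relations), defined as a measurable and isometry-equivariant function
of the configuration. -/
structure Clumping (d : ℕ) where
  /-- the `i`-th partition of the points of the configuration `S` -/
  part : ℕ → (S : Config d) → Setoid S.points
  coarser : ∀ (i : ℕ) (S : Config d) (x y : S.points), part i S x y → part (i + 1) S x y
  equivariant : ∀ (i : ℕ) (γ : Eucl d ≃ᵢ Eucl d) (S : Config d) (x y : S.points),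
    part i (S.map γ) (S.move γ x) (S.move γ y) ↔ part i S x y
  measurable : ∀ i : ℕ, MeasurableSet {p : Config d × Eucl d × Eucl d |
    ∃ (hx : p.2.1 ∈ p.1.points) (hy : p.2.2 ∈ p.1.points),
      part i p.1 ⟨p.2.1, hx⟩ ⟨p.2.2, hy⟩}

/-- The clumps of the `i`-th partition of the points of `S`. -/
def Clumping.clumps {d : ℕ} (P : Clumping d) (i : ℕ) (S : Config d) : Set (Set S.points) :=
  (P.part i S).classes

/-- A clumping is connected on the configuration `S` if any two points of `S` lie in the same
clump of one of the partitions. -/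
def Clumping.ConnectedOn {d : ℕ} (P : Clumping d) (S : Config d) : Prop :=
  ∀ x y : S.points, ∃ i : ℕ, ∃ C ∈ P.clumps i S, x ∈ C ∧ y ∈ C

/-! The clumping is built in finite pieces whose failure probabilities are summable. First, the
index function yields an increasing sequence of equivalence relations `E k` with finite classes that
eventually join any two points (`exists_finite_connected`). Each point goes to the net point of
least index within distance `ρ`. A ball around the origin is cut only if a net point lies near the
sphere of radius `ρ`. Sparse nets and an average over many radii make this unlikely, and
intersecting the tails of a sequence of such partitions gives the `E k`.

The classes of `E k` have uncontrolled sizes. The heart is therefore `exists_extension`, which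
starts from a partition into classes of size `q` and adds finitely many doublings so that a given
ball very likely falls into a single class. Each class is replaced by its point of least index. The
representatives in a finite class of a coarse `E k` are listed in a linear order and cut into blocks
of length `2 ^ m`, with a shift `t`. Only full blocks are kept, and the remaining representatives
are treated again in the next, larger class. What is never used is finite, because each class leaves
at most `2 * 2 ^ m` points. Sub-blocks of length `2 ^ j` give the intermediate levels.

Invariance enters through `ae_infinite_of_nonempty`: no finite nonempty set of points can be
selected equivariantly. Hence the finite remainder is empty. Likewise the order has no first or last
representative, so those near the origin eventually lie far from both ends of their class. They are
then in full blocks, and few shifts separate them.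

Iterating with growing balls, Borel–Cantelli gives connectedness (`exists_dyadic`). All choices of
radii, shifts and levels are deterministic numbers, so everything stays equivariant; `Adm` carries
measurability and equivariance together, and `fun_prop` propagates both. -/

/-! ### Measurable equivariant functions -/

/-- A type on which the isometries of `ℝ^d` act. -/
class IsoAct (d : ℕ) (α : Type) where
  /-- the action -/
  act : (Eucl d ≃ᵢ Eucl d) → α → α

/-- A type on which the isometries of `ℝ^d` act trivially. -/
class TrivAct (d : ℕ) (α : Type) extends IsoAct d α where
  act_eq : ∀ g a, act g a = a

open IsoAct

section Act

variable {d : ℕ} {α β : Type}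

noncomputable instance : IsoAct d (Config d) := ⟨Config.map⟩

noncomputable instance : IsoAct d (Eucl d) := ⟨fun g x => g x⟩

instance [IsoAct d α] [IsoAct d β] : IsoAct d (α × β) := ⟨fun g p => (act g p.1, act g p.2)⟩

instance : TrivAct d Prop where
  act _ p := p
  act_eq _ _ := rfl

instance : TrivAct d ℕ where
  act _ n := n
  act_eq _ _ := rfl

instance : TrivAct d ℝ where
  act _ n := n
  act_eq _ _ := rfl

theorem act_config (g : Eucl d ≃ᵢ Eucl d) (S : Config d) : act g S = S.map g := rfl

theorem act_eucl (g : Eucl d ≃ᵢ Eucl d) (x : Eucl d) : act g x = g x := rfl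

theorem act_prod [IsoAct d α] [IsoAct d β] (g : Eucl d ≃ᵢ Eucl d) (p : α × β) :
    act g p = (act g p.1, act g p.2) := rfl

@[simp]
theorem act_triv [TrivAct d α] (g : Eucl d ≃ᵢ Eucl d) (a : α) : act g a = a :=
  TrivAct.act_eq g a

end Act

/-- Measurable functions that commute with the isometries of `ℝ^d`. -/
@[fun_prop]
structure Adm (d : ℕ) {α β : Type} [MeasurableSpace α] [MeasurableSpace β] [IsoAct d α]
    [IsoAct d β] (f : α → β) : Prop where
  meas : Measurable f
  equiv : ∀ (g : Eucl d ≃ᵢ Eucl d) (a : α), f (act g a) = act g (f a)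

namespace Adm

variable {d : ℕ} {α β γ δ : Type} [MeasurableSpace α] [MeasurableSpace β] [MeasurableSpace γ]
  [MeasurableSpace δ] [IsoAct d α] [IsoAct d β] [IsoAct d γ] [IsoAct d δ]

@[fun_prop]
theorem id : Adm d (fun a : α => a) := ⟨measurable_id, fun _ _ => rfl⟩

@[fun_prop]
theorem comp {f : β → γ} {h : α → β} (hf : Adm d f) (hh : Adm d h) : Adm d (fun a => f (h a)) :=
  ⟨hf.meas.comp hh.meas, fun g a => by rw [hh.equiv, hf.equiv]⟩

@[fun_prop]
theorem fst {f : α → β × γ} (hf : Adm d f) : Adm d (fun a => (f a).1) :=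
  ⟨hf.meas.fst, fun g a => by rw [hf.equiv, act_prod]⟩

@[fun_prop]
theorem snd {f : α → β × γ} (hf : Adm d f) : Adm d (fun a => (f a).2) :=
  ⟨hf.meas.snd, fun g a => by rw [hf.equiv, act_prod]⟩

@[fun_prop]
theorem prodMk {f : α → β} {h : α → γ} (hf : Adm d f) (hh : Adm d h) :
    Adm d (fun a => (f a, h a)) :=
  ⟨hf.meas.prodMk hh.meas, fun g a => by rw [hf.equiv, hh.equiv, act_prod]⟩

@[fun_prop]
theorem const {ε : Type} [MeasurableSpace ε] [TrivAct d ε] (e : ε) : Adm d (fun _ : α => e) :=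
  ⟨measurable_const, fun g a => by rw [act_triv]⟩

theorem trivComp₂ {ε ζ η : Type} [MeasurableSpace ε] [TrivAct d ε] [MeasurableSpace ζ]
    [TrivAct d ζ] [MeasurableSpace η] [TrivAct d η]
    {h : ε → ζ → η} (hh : Measurable (fun p : ε × ζ => h p.1 p.2)) {f : α → ε} {k : α → ζ}
    (hf : Adm d f) (hk : Adm d k) : Adm d (fun a => h (f a) (k a)) :=
  ⟨hh.comp (hf.meas.prodMk hk.meas), fun g a => by rw [hf.equiv, hk.equiv]; simp⟩

@[fun_prop]
theorem and {p q : α → Prop} (hp : Adm d p) (hq : Adm d q) : Adm d (fun a => p a ∧ q a) :=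
  ⟨hp.meas.and hq.meas, fun g a => by rw [hp.equiv, hq.equiv]; simp⟩

@[fun_prop]
theorem or {p q : α → Prop} (hp : Adm d p) (hq : Adm d q) : Adm d (fun a => p a ∨ q a) :=
  ⟨hp.meas.or hq.meas, fun g a => by rw [hp.equiv, hq.equiv]; simp⟩

@[fun_prop]
theorem not {p : α → Prop} (hp : Adm d p) : Adm d (fun a => ¬ p a) :=
  ⟨hp.meas.not, fun g a => by rw [hp.equiv]; simp⟩

@[fun_prop]
theorem imp {p q : α → Prop} (hp : Adm d p) (hq : Adm d q) : Adm d (fun a => p a → q a) :=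
  ⟨hp.meas.imp hq.meas, fun g a => by rw [hp.equiv, hq.equiv]; simp⟩

@[fun_prop]
theorem iff {p q : α → Prop} (hp : Adm d p) (hq : Adm d q) : Adm d (fun a => p a ↔ q a) :=
  ⟨hp.meas.iff hq.meas, fun g a => by rw [hp.equiv, hq.equiv]; simp⟩

@[fun_prop]
theorem all {ι : Type} [Countable ι] {p : ι → α → Prop} (hp : ∀ i, Adm d (p i)) :
    Adm d (fun a => ∀ i, p i a) :=
  ⟨Measurable.forall fun i => (hp i).meas, fun g a => by simp [(hp _).equiv]⟩

@[fun_prop]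
theorem ex {ι : Type} [Countable ι] {p : ι → α → Prop} (hp : ∀ i, Adm d (p i)) :
    Adm d (fun a => ∃ i, p i a) :=
  ⟨Measurable.exists fun i => (hp i).meas, fun g a => by simp [(hp _).equiv]⟩

@[fun_prop]
theorem lt_real {f h : α → ℝ} (hf : Adm d f) (hh : Adm d h) : Adm d (fun a => f a < h a) :=
  trivComp₂ (h := fun x y : ℝ => x < y)
    (measurableSet_setOfPred.1 (measurableSet_lt measurable_fst measurable_snd)) hf hh

@[fun_prop]
theorem le_real {f h : α → ℝ} (hf : Adm d f) (hh : Adm d h) : Adm d (fun a => f a ≤ h a) :=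
  trivComp₂ (h := fun x y : ℝ => x ≤ y)
    (measurableSet_setOfPred.1 (measurableSet_le measurable_fst measurable_snd)) hf hh

@[fun_prop]
theorem le_nat {f h : α → ℕ} (hf : Adm d f) (hh : Adm d h) : Adm d (fun a => f a ≤ h a) :=
  trivComp₂ (h := fun x y : ℕ => x ≤ y) (measurable_of_countable _) hf hh

@[fun_prop]
theorem eq_nat {f h : α → ℕ} (hf : Adm d f) (hh : Adm d h) : Adm d (fun a => f a = h a) :=
  trivComp₂ (h := fun x y : ℕ => x = y) (measurable_of_countable _) hf hh

@[fun_prop]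
theorem add_nat {f h : α → ℕ} (hf : Adm d f) (hh : Adm d h) : Adm d (fun a => f a + h a) :=
  trivComp₂ (h := fun x y : ℕ => x + y) (measurable_of_countable _) hf hh

@[fun_prop]
theorem div_nat {f h : α → ℕ} (hf : Adm d f) (hh : Adm d h) : Adm d (fun a => f a / h a) :=
  trivComp₂ (h := fun x y : ℕ => x / y) (measurable_of_countable _) hf hh

@[fun_prop]
theorem dist {f h : α → Eucl d} (hf : Adm d f) (hh : Adm d h) :
    Adm d (fun a => Dist.dist (f a) (h a)) :=
  ⟨hf.meas.dist hh.meas, fun g a => by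
    rw [hf.equiv, hh.equiv, act_triv]; exact g.isometry.dist_eq _ _⟩

@[fun_prop]
theorem eq_eucl {f h : α → Eucl d} (hf : Adm d f) (hh : Adm d h) :
    Adm d (fun a => f a = h a) :=
  ⟨measurableSet_setOfPred.1 (measurableSet_eq_fun hf.meas hh.meas), fun g a => by
    rw [hf.equiv, hh.equiv, act_triv]; simp only [act_eucl, g.injective.eq_iff]⟩

end Adm

/-! ### Counting points -/

namespace Config

variable {d : ℕ}

theorem measurable_count {B : Set (Eucl d)} (hB : MeasurableSet B) : Measurable (count B) :=
  Measurable.of_comap_le (le_iSup₂_of_le B hB le_rfl)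

theorem finite_inter_closedBall (S : Config d) (x : Eucl d) (r : ℝ) :
    (S.points ∩ Metric.closedBall x r).Finite :=
  S.locallyFinite _ Metric.isBounded_closedBall

theorem measurableSet_points_inter (S : Config d) (r : ℝ) :
    MeasurableSet (S.points ∩ Metric.closedBall 0 r) :=
  (S.finite_inter_closedBall 0 r).measurableSet

/-- The counting measure of the points of a configuration in a ball. -/
noncomputable def ballMeasure (r : ℝ) (S : Config d) : Measure (Eucl d) :=
  Measure.count.restrict (S.points ∩ Metric.closedBall 0 r)

theorem ballMeasure_apply (r : ℝ) (S : Config d) {B : Set (Eucl d)} (hB : MeasurableSet B) :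
    ballMeasure r S B = ((B ∩ (S.points ∩ Metric.closedBall 0 r)).encard : ℝ≥0∞) := by
  rw [ballMeasure, Measure.restrict_apply hB,
    Measure.count_apply (hB.inter (S.measurableSet_points_inter r))]

instance (r : ℝ) (S : Config d) : IsFiniteMeasure (ballMeasure r S) := by
  refine ⟨?_⟩
  rw [ballMeasure_apply r S MeasurableSet.univ, Set.univ_inter]
  have := (S.finite_inter_closedBall 0 r).encard_lt_top
  exact ENat.toENNReal_lt_top.2 this

theorem measurable_ballMeasure (r : ℝ) : Measurable (ballMeasure (d := d) r) := by
  refine Measure.measurable_of_measurable_coe _ fun B hB => ?_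
  have h : (fun S => ballMeasure r S B) =
      fun S : Config d => (count (B ∩ Metric.closedBall 0 r) S : ℝ≥0∞) := by
    funext S
    rw [ballMeasure_apply r S hB, count]
    congr 2
    ext x
    simp only [Set.mem_inter_iff]
    tauto
  rw [h]
  exact (measurable_of_countable _).comp
    (measurable_count (hB.inter Metric.isClosed_closedBall.measurableSet))

/-- Restricted to balls, the counting measures of the points form a kernel of finite measures, for
which measures of sections are measurable. The count is the supremum over balls. This is what makes
quantifying over and counting the points of a configuration measurable. -/
theorem measurable_encard {α : Type} [MeasurableSpace α] {c : α → Config d} (hc : Measurable c)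
    {p : α × Eucl d → Prop} (hp : Measurable p) :
    Measurable (fun a => (({y ∈ (c a).points | p (a, y)}.encard : ℕ∞) : ℝ≥0∞)) := by
  have hpm : MeasurableSet {q | p q} := measurableSet_setOfPred.2 hp
  have h : (fun a => (({y ∈ (c a).points | p (a, y)}.encard : ℕ∞) : ℝ≥0∞)) =
      fun a => ⨆ n : ℕ, ballMeasure n (c a) (Prod.mk a ⁻¹' {q | p q}) := by
    funext a
    have hs : {y ∈ (c a).points | p (a, y)} =
        ⋃ n : ℕ, {y | p (a, y)} ∩ ((c a).points ∩ Metric.closedBall 0 (n : ℝ)) := by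
      ext y
      obtain ⟨n, hn⟩ := exists_nat_ge ‖y‖
      simp only [Set.mem_iUnion, Set.mem_inter_iff, mem_closedBall_zero_iff]
      constructor
      · exact fun h => ⟨n, h.2, h.1, hn⟩
      · exact fun ⟨n, h⟩ => ⟨h.2.1, h.1⟩
    have hm : ∀ n : ℕ, MeasurableSet
        ({y | p (a, y)} ∩ ((c a).points ∩ Metric.closedBall 0 (n : ℝ))) :=
      fun n => (((c a).finite_inter_closedBall 0 n).subset Set.inter_subset_right).measurableSet
    have hmono : Monotone fun n : ℕ =>
        {y | p (a, y)} ∩ ((c a).points ∩ Metric.closedBall 0 (n : ℝ)) := by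
      intro m n hmn y hy
      exact ⟨hy.1, hy.2.1, Metric.closedBall_subset_closedBall (by exact_mod_cast hmn) hy.2.2⟩
    rw [← Measure.count_apply (by rw [hs]; exact MeasurableSet.iUnion hm), hs,
      hmono.measure_iUnion]
    refine iSup_congr fun n => ?_
    rw [Measure.count_apply (hm n), ballMeasure_apply _ _ (measurable_prodMk_left hpm)]
    rfl
  rw [h]
  refine Measurable.iSup fun n => ?_
  let κ : ProbabilityTheory.Kernel α (Eucl d) :=
    ⟨fun a => ballMeasure n (c a), (measurable_ballMeasure _).comp hc⟩
  exact ProbabilityTheory.Kernel.measurable_kernel_prodMk_left_of_finite (κ := κ) hpm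
    (fun a => inferInstanceAs (IsFiniteMeasure (ballMeasure n (c a))))

end Config

namespace Adm

variable {d : ℕ} {α : Type} [MeasurableSpace α] [IsoAct d α]

theorem image_points {c : α → Config d} (hc : Adm d c) {p : α × Eucl d → Prop} (hp : Adm d p)
    (g : Eucl d ≃ᵢ Eucl d) (a : α) :
    {y ∈ (c (act g a)).points | p (act g a, y)} = g '' {y ∈ (c a).points | p (a, y)} := by
  have h : ∀ y, p (act g a, g y) = p (a, y) := fun y =>
    (hp.equiv g (a, y)).trans (act_triv g _)
  ext y
  rw [hc.equiv]
  constructor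
  · rintro ⟨⟨x, hx, rfl⟩, hy⟩
    exact ⟨x, ⟨hx, (h x) ▸ hy⟩, rfl⟩
  · rintro ⟨x, ⟨hx, hy⟩, rfl⟩
    exact ⟨⟨x, hx, rfl⟩, (h x).symm ▸ hy⟩

@[fun_prop]
theorem ncard {c : α → Config d} (hc : Adm d c) {p : α → Eucl d → Prop}
    (hp : Adm d (fun q : α × Eucl d => p q.1 q.2)) :
    Adm d (fun a => {y | y ∈ (c a).points ∧ p a y}.ncard) := by
  constructor
  · have h := Config.measurable_encard hc.meas hp.meas
    have h2 : (fun a => {y | y ∈ (c a).points ∧ p a y}.ncard) =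
      -- An infinite set has `ncard` equal to `0`, which agrees with `toReal` sending `∞` to `0`.
      fun a => (fun e : ℝ≥0∞ => ⌊e.toReal⌋₊)
        (({y ∈ (c a).points | p a y}.encard : ℕ∞) : ℝ≥0∞) := by
      funext a
      simp only [Set.ncard_def]
      generalize {y | y ∈ (c a).points ∧ p a y}.encard = e
      cases e <;> simp
    rw [h2]
    exact (Nat.measurable_floor.comp ENNReal.measurable_toReal).comp h
  · intro g a
    rw [image_points hc hp g a, Set.ncard_image_of_injective _ g.injective]
    simp

@[fun_prop]
theorem exists_mem {c : α → Config d} (hc : Adm d c) {p : α → Eucl d → Prop}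
    (hp : Adm d (fun q : α × Eucl d => p q.1 q.2)) :
    Adm d (fun a => ∃ y ∈ (c a).points, p a y) := by
  have he : ∀ a, (∃ y ∈ (c a).points, p a y) ↔
      {y ∈ (c a).points | p a y}.Nonempty := fun a => Iff.rfl
  constructor
  · have h := Config.measurable_encard hc.meas hp.meas
    have h2 : {a | ∃ y ∈ (c a).points, p a y} =
        {a | (({y ∈ (c a).points | p a y}.encard : ℕ∞) : ℝ≥0∞) = 0}ᶜ := by
      ext a
      simp only [Set.mem_compl_iff, Set.mem_ofPred_eq, ENat.toENNReal_eq_zero, Set.encard_eq_zero,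
        he, Set.nonempty_iff_ne_empty, ne_eq]
    rw [← measurableSet_setOfPred, h2]
    exact (h (measurableSet_singleton 0)).compl
  · intro g a
    rw [he, image_points hc hp g a, Set.image_nonempty, act_triv, he]

@[fun_prop]
theorem forall_mem {c : α → Config d} (hc : Adm d c) {p : α → Eucl d → Prop}
    (hp : Adm d (fun q : α × Eucl d => p q.1 q.2)) :
    Adm d (fun a => ∀ y ∈ (c a).points, p a y) := by
  have := (exists_mem hc (p := fun a y => ¬ p a y) hp.not).not
  push Not at this
  exact this

@[fun_prop]
theorem mem {c : α → Config d} (hc : Adm d c) {x : α → Eucl d} (hx : Adm d x) :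
    Adm d (fun a => x a ∈ (c a).points) := by
  have := exists_mem hc (p := fun a y => y = x a) (by fun_prop)
  simpa using this

end Adm

/-! ### Almost sure events -/

section Prob

variable {Ω : Type*} [MeasurableSpace Ω] (μ : Measure Ω)

/-- Turns a level that depends on the configuration into a deterministic one, at the price of a
small exceptional event. -/
theorem exists_measure_not_le [IsFiniteMeasure μ] {p : ℕ → Ω → Prop} (hp : ∀ k, Measurable (p k))
    (h : ∀ᵐ ω ∂μ, ∀ᶠ k in Filter.atTop, p k ω) {ε : ℝ≥0∞} (hε : 0 < ε) (k₀ : ℕ) :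
    ∃ k ≥ k₀, μ {ω | ¬ p k ω} ≤ ε := by
  have hlim : Filter.Tendsto (fun k => μ {ω | ¬ p k ω}) Filter.atTop (nhds (μ ∅)) := by
    refine tendsto_measure_of_ae_tendsto_indicator_of_isFiniteMeasure _ MeasurableSet.empty
      (fun k => measurableSet_setOfPred.2 (hp k).not) ?_
    filter_upwards [h] with ω hω
    filter_upwards [hω] with k hk
    simp [hk]
  rw [measure_empty] at hlim
  obtain ⟨k, hk, hk'⟩ := ((hlim.eventually_le_const hε).and
    (Filter.eventually_ge_atTop k₀)).exists
  exact ⟨k, hk', hk⟩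

/-- Averaging: the probabilities sum to the expected number of events that occur, which is at most
`N`. It derandomizes the choice of a radius or a shift. -/
theorem exists_measure_le_div [IsProbabilityMeasure μ] {A : ℕ → Ω → Prop}
    (hA : ∀ t, Measurable (A t)) {K : ℕ} (hK : 0 < K) (N : ℕ)
    (h : ∀ᵐ ω ∂μ, ∀ T : Finset ℕ, T ⊆ Finset.range K → (∀ t ∈ T, A t ω) → T.card ≤ N) :
    ∃ t < K, μ {ω | A t ω} ≤ N / K := by
  classical
  have hm : ∀ t, MeasurableSet {ω | A t ω} := fun t => measurableSet_setOfPred.2 (hA t)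
  have hsum : ∑ t ∈ Finset.range K, μ {ω | A t ω} ≤ ∑ t ∈ Finset.range K, (N / K : ℝ≥0∞) := by
    calc ∑ t ∈ Finset.range K, μ {ω | A t ω}
        = ∑ t ∈ Finset.range K, ∫⁻ ω, {ω | A t ω}.indicator 1 ω ∂μ := by
          refine Finset.sum_congr rfl fun t _ => ?_
          rw [lintegral_indicator_one (hm t)]
      _ = ∫⁻ ω, ∑ t ∈ Finset.range K, {ω | A t ω}.indicator 1 ω ∂μ := by
          rw [lintegral_finsetSum]
          exact fun t _ => measurable_one.indicator (hm t)
      _ ≤ ∫⁻ _, (N : ℝ≥0∞) ∂μ := by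
          refine lintegral_mono_ae ?_
          filter_upwards [h] with ω hω
          have := hω ((Finset.range K).filter fun t => A t ω) (Finset.filter_subset _ _)
            (fun t ht => (Finset.mem_filter.1 ht).2)
          simp only [Set.indicator_apply, Set.mem_ofPred_eq, Pi.one_apply, Finset.sum_boole]
          exact_mod_cast this
      _ = N := by simp
      _ = ∑ t ∈ Finset.range K, (N / K : ℝ≥0∞) := by
          rw [Finset.sum_const, Finset.card_range, nsmul_eq_mul,
            ENNReal.mul_div_cancel (by exact_mod_cast hK.ne') (by simp)]
  by_contra! hcon
  exact hsum.not_gt (ENNReal.sum_lt_sum_of_nonempty (Finset.nonempty_range_iff.2 hK.ne')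
    fun t ht => hcon t (Finset.mem_range.1 ht))

theorem ae_eventually_of_measure_not_le {p : ℕ → Ω → Prop} {δ : ℕ → ℝ≥0∞}
    (hδ : ∑' n, δ n ≠ ∞) (h : ∀ n, μ {ω | ¬ p n ω} ≤ δ n) :
    ∀ᵐ ω ∂μ, ∀ᶠ n in Filter.atTop, p n ω := by
  have := ae_eventually_notMem (μ := μ) (s := fun n => {ω | ¬ p n ω})
    (ne_top_of_le_ne_top hδ (ENNReal.tsum_le_tsum h))
  simpa using this

end Prob

/-! ### Equivariant selection of finite sets -/

section Selection

variable {d : ℕ} {μ : Measure (Config d)} [IsProbabilityMeasure μ]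

/-- By translation invariance, being confined to a ball of radius `r` has the same probability for
every center. For centers more than `2 * r` apart these events are disjoint, and there are
infinitely many such centers. -/
theorem measure_confined_eq_zero (hd : 1 ≤ d) (hinv : IsometryInvariant μ)
    {A : Config d × Eucl d → Prop} (hA : Adm d A) (r : ℕ) :
    μ {S | (∃ x ∈ S.points, A (S, x)) ∧ ∀ x ∈ S.points, A (S, x) → dist x 0 ≤ r} = 0 := by
  -- The origin is not preserved by isometries, so the center becomes a second, moving argument.
  let H : Config d × Eucl d → Prop := fun q =>
    (∃ x ∈ q.1.points, A (q.1, x)) ∧ ∀ x ∈ q.1.points, A (q.1, x) → dist x q.2 ≤ r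
  have hH : Adm d H := by fun_prop
  have hmeas : ∀ u, MeasurableSet {S | H (S, u)} := fun u =>
    measurableSet_setOfPred.2 (hH.meas.comp measurable_prodMk_right)
  have hconst : ∀ u, μ {S | H (S, u)} = μ {S | H (S, 0)} := by
    intro u
    have hmp := hinv (IsometryEquiv.vaddConst u : Eucl d ≃ᵢ Eucl d)
    rw [← hmp.measure_preimage (hmeas u).nullMeasurableSet]
    congr 1
    ext S
    have h := (hH.equiv (IsometryEquiv.vaddConst u : Eucl d ≃ᵢ Eucl d) (S, 0)).trans (act_triv _ _)
    have h0 : IsoAct.act (IsometryEquiv.vaddConst u : Eucl d ≃ᵢ Eucl d) (S, (0 : Eucl d)) =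
        (S.map (IsometryEquiv.vaddConst u : Eucl d ≃ᵢ Eucl d), u) := by
      simp [act_prod, act_config, act_eucl]
    rw [h0] at h
    exact iff_of_eq h
  let e : Eucl d := EuclideanSpace.single ⟨0, hd⟩ 1
  have he : ‖e‖ = 1 := by simp [e]
  let v : ℕ → Eucl d := fun n => ((n : ℝ) * (2 * r + 1)) • e
  have hdisj : Pairwise (Function.onFun Disjoint fun n => {S | H (S, v n)}) := by
    intro m n hmn
    refine Set.disjoint_left.2 ?_
    rintro S ⟨⟨x, hx, hAx⟩, hm⟩ ⟨-, hn⟩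
    have h1 := hm x hx hAx
    have h2 := hn x hx hAx
    have h3 : dist (v m) (v n) = |(m : ℝ) - n| * (2 * r + 1) := by
      rw [dist_eq_norm, ← sub_smul, ← sub_mul, norm_smul, he, mul_one, Real.norm_eq_abs, abs_mul,
        abs_of_pos (by positivity : (0 : ℝ) < 2 * r + 1)]
    have h4 : (1 : ℝ) ≤ |(m : ℝ) - n| := by
      have : (1 : ℤ) ≤ |(m : ℤ) - n| := Int.one_le_abs (sub_ne_zero.2 (by exact_mod_cast hmn))
      exact_mod_cast this
    have h5 := dist_triangle_left (v m) (v n) x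
    nlinarith [(Nat.cast_nonneg r : (0 : ℝ) ≤ r)]
  have htop : ∑' _ : ℕ, μ {S | H (S, 0)} ≠ ∞ := by
    have h1 := tsum_measure_le_measure_univ (μ := μ) (fun n => (hmeas (v n)).nullMeasurableSet)
      (hdisj.mono fun _ _ h => h.aedisjoint)
    simp only [hconst] at h1
    exact ne_top_of_le_ne_top (measure_ne_top μ _) h1
  by_contra hne
  exact htop (ENNReal.tsum_const_eq_top_of_ne_zero hne)

/-- An invariant point process has no finite nonempty equivariantly chosen set of points. -/
theorem ae_infinite_of_nonempty (hd : 1 ≤ d) (hinv : IsometryInvariant μ)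
    {A : Config d × Eucl d → Prop} (hA : Adm d A) :
    ∀ᵐ S ∂μ, {x ∈ S.points | A (S, x)}.Finite → ∀ x ∈ S.points, ¬ A (S, x) := by
  have h : ∀ᵐ S ∂μ, ∀ r : ℕ,
      ¬ ((∃ x ∈ S.points, A (S, x)) ∧ ∀ x ∈ S.points, A (S, x) → dist x 0 ≤ r) := by
    rw [ae_all_iff]
    intro r
    rw [ae_iff]
    simpa only [not_not] using measure_confined_eq_zero hd hinv hA r
  filter_upwards [h] with S hS hfin x hx hAx
  obtain ⟨R, hR⟩ := (hfin.isBounded).subset_closedBall (0 : Eucl d)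
  obtain ⟨r, hr⟩ := exists_nat_ge R
  exact hS r ⟨⟨x, hx, hAx⟩, fun y hy hAy => (hR ⟨hy, hAy⟩ : dist y 0 ≤ R).trans hr⟩

end Selection

/-! ### Nets and partitions into bounded classes -/

/-- Equivariance is given only at points of the configuration; setting the index to `0` elsewhere
makes it hold everywhere. -/
theorem AllowsIndexFunction.exists_adm {d : ℕ} {μ : Measure (Config d)}
    (h : AllowsIndexFunction μ) : ∃ ι : Config d × Eucl d → ℝ, Adm d ι ∧
      ∀ᵐ S ∂μ, Set.InjOn (fun x => ι (S, x)) S.points := by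
  classical
  obtain ⟨ι, hm, he, hinj⟩ := h
  have hmem : Adm d (fun p : Config d × Eucl d => p.2 ∈ p.1.points) := by fun_prop
  refine ⟨fun p => if p.2 ∈ p.1.points then ι p.1 p.2 else 0,
    ⟨Measurable.ite (measurableSet_setOfPred.2 hmem.meas) hm measurable_const, ?_⟩, ?_⟩
  · rintro g ⟨S, x⟩
    have h1 := (hmem.equiv g (S, x)).trans (act_triv _ _)
    rw [act_triv]
    simp only [act_prod, act_config, act_eucl] at h1 ⊢
    rw [h1]
    by_cases hx : x ∈ S.points
    · simp [hx, he g S x hx]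
    · simp [hx]
  · filter_upwards [hinj] with S hS x hx y hy hxy
    exact hS hx hy (by simpa [hx, hy] using hxy)

section Net

variable {d : ℕ} (ι : Config d × Eucl d → ℝ) (s : ℝ)

/-- An enumeration of the pairs of rational numbers. -/
noncomputable def ratPair : ℕ → ℚ × ℚ := (exists_surjective_nat (ℚ × ℚ)).choose

theorem ratPair_surjective : Function.Surjective ratPair :=
  (exists_surjective_nat (ℚ × ℚ)).choose_spec

/-- The index of the point lies in the `n`-th rational interval, which contains no index of
another point at distance at most `s`. -/
def Isolated (n : ℕ) : Config d × Eucl d → Prop := fun p =>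
  ((ratPair n).1 : ℝ) < ι p ∧ ι p < ((ratPair n).2 : ℝ) ∧
    ∀ y ∈ p.1.points, dist p.2 y ≤ s → ((ratPair n).1 : ℝ) < ι (p.1, y) →
      ι (p.1, y) < ((ratPair n).2 : ℝ) → y = p.2

/-- The greedy construction of a maximal `s`-separated set of points. -/
def NetUpTo : ℕ → Config d × Eucl d → Prop
  | 0 => fun _ => False
  | n + 1 => fun p => NetUpTo n p ∨ (p.2 ∈ p.1.points ∧ Isolated ι s n p ∧
      ∀ y ∈ p.1.points, dist p.2 y ≤ s → ¬ NetUpTo n (p.1, y))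

/-- A maximal `s`-separated set of points. -/
def Net : Config d × Eucl d → Prop := fun p => ∃ n, NetUpTo ι s n p

variable {ι s}

theorem adm_isolated (hι : Adm d ι) (n : ℕ) : Adm d (Isolated ι s n) := by
  unfold Isolated
  fun_prop

theorem adm_netUpTo (hι : Adm d ι) (n : ℕ) : Adm d (NetUpTo ι s n) := by
  induction n with
  | zero => unfold NetUpTo; fun_prop
  | succ n ih =>
    have := adm_isolated (s := s) hι n
    unfold NetUpTo
    fun_prop

theorem adm_net (hι : Adm d ι) : Adm d (Net ι s) := by
  have := adm_netUpTo (s := s) hι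
  unfold Net
  fun_prop

theorem NetUpTo.mem {n : ℕ} {S : Config d} {x : Eucl d} (h : NetUpTo ι s n (S, x)) :
    x ∈ S.points := by
  induction n with
  | zero => exact h.elim
  | succ n ih => exact h.elim ih fun h => h.1

theorem Net.mem {S : Config d} {x : Eucl d} (h : Net ι s (S, x)) : x ∈ S.points :=
  h.choose_spec.mem

theorem NetUpTo.mono {m n : ℕ} (hmn : m ≤ n) {p : Config d × Eucl d} (h : NetUpTo ι s m p) :
    NetUpTo ι s n p := by
  induction n, hmn using Nat.le_induction with
  | base => exact h
  | succ n _ ih => exact Or.inl ih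

/-- Points added at the same step cannot be close, since both have their index in the same rational
interval and are isolated there; a later point is added only if no earlier one is close. -/
theorem NetUpTo.eq_of_dist_le {n : ℕ} {S : Config d} {x y : Eucl d}
    (hx : NetUpTo ι s n (S, x)) (hy : NetUpTo ι s n (S, y)) (hxy : dist x y ≤ s) : x = y := by
  induction n with
  | zero => exact hx.elim
  | succ n ih =>
    rcases hx with hx | ⟨hx, hxi, hxn⟩ <;> rcases hy with hy | ⟨hy, hyi, hyn⟩
    · exact ih hx hy
    · exact (hyn x hx.mem (by rwa [dist_comm]) hx).elim
    · exact (hxn y hy.mem hxy hy).elim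
    · exact (hxi.2.2 y hy hxy hyi.1 hyi.2.1).symm

theorem Net.eq_of_dist_le {S : Config d} {x y : Eucl d}
    (hx : Net ι s (S, x)) (hy : Net ι s (S, y)) (hxy : dist x y ≤ s) : x = y := by
  obtain ⟨m, hm⟩ := hx
  obtain ⟨n, hn⟩ := hy
  exact (hm.mono (le_max_left m n)).eq_of_dist_le (hn.mono (le_max_right m n)) hxy

/-- Only finitely many other points are within distance `s`, so a small rational interval around the
index avoids theirs. -/
theorem exists_isolated {S : Config d} (hinj : Set.InjOn (fun x => ι (S, x)) S.points)
    {x : Eucl d} (hx : x ∈ S.points) : ∃ n, Isolated ι s n (S, x) := by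
  have hfin : ((fun y => ι (S, y)) '' ((S.points ∩ Metric.closedBall x s) \ {x})).Finite :=
    (((S.finite_inter_closedBall x s)).sdiff).image _
  have hnhds : ((fun y => ι (S, y)) '' ((S.points ∩ Metric.closedBall x s) \ {x}))ᶜ ∈
      nhds (ι (S, x)) := by
    refine hfin.isClosed.isOpen_compl.mem_nhds ?_
    rintro ⟨y, ⟨⟨hy, -⟩, hyx⟩, h⟩
    exact hyx (hinj hy hx h)
  obtain ⟨a, b, ⟨ha, hb⟩, hab⟩ := (mem_nhds_iff_exists_Ioo_subset).1 hnhds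
  obtain ⟨p, hap, hpx⟩ := exists_rat_btwn ha
  obtain ⟨q, hxq, hqb⟩ := exists_rat_btwn hb
  obtain ⟨n, hn⟩ := ratPair_surjective (p, q)
  refine ⟨n, ?_⟩
  simp only [Isolated, hn]
  refine ⟨hpx, hxq, fun y hy hxy h1 h2 => ?_⟩
  by_contra hne
  exact hab ⟨hap.trans h1, h2.trans hqb⟩ ⟨y, ⟨⟨hy, by rwa [Metric.mem_closedBall, dist_comm]⟩,
    hne⟩, rfl⟩

/-- Maximality: when its turn comes, a point is either added or blocked by a close net point. -/
theorem exists_net_dist_le (hs : 0 ≤ s) {S : Config d}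
    (hinj : Set.InjOn (fun x => ι (S, x)) S.points) {x : Eucl d} (hx : x ∈ S.points) :
    ∃ y ∈ S.points, dist x y ≤ s ∧ Net ι s (S, y) := by
  obtain ⟨n, hn⟩ := exists_isolated (s := s) hinj hx
  by_cases h : ∀ y ∈ S.points, dist x y ≤ s → ¬ NetUpTo ι s n (S, y)
  · exact ⟨x, hx, by simpa using hs, n + 1, Or.inr ⟨hx, hn, h⟩⟩
  · push Not at h
    obtain ⟨y, hy, hxy, hny⟩ := h
    exact ⟨y, hy, hxy, n, hny⟩

/-- After scaling by `s⁻¹` this is the packing bound for separated points in a ball of radius `2`.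
-/
theorem card_net_le (hs : 0 < s) {S : Config d} (T : Finset (Eucl d))
    (hT : ∀ a ∈ T, Net ι s (S, a) ∧ ‖a‖ ≤ 2 * s) : T.card ≤ 5 ^ d := by
  classical
  have hinj : Function.Injective fun a : Eucl d => s⁻¹ • a :=
    smul_right_injective _ (inv_ne_zero hs.ne')
  have h := Besicovitch.card_le_of_separated (T.image fun a => s⁻¹ • a) ?_ ?_
  · rwa [Finset.card_image_of_injective _ hinj, finrank_euclideanSpace_fin] at h
  · simp only [Finset.mem_image, forall_exists_index, and_imp, forall_apply_eq_imp_iff₂]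
    intro a ha
    rw [norm_smul, norm_inv, Real.norm_of_nonneg hs.le, inv_mul_le_iff₀ hs]
    linarith [(hT a ha).2]
  · simp only [Finset.mem_image, forall_exists_index, and_imp, forall_apply_eq_imp_iff₂]
    intro a ha b hb hab
    have hne : a ≠ b := fun h => hab (by rw [h])
    have : s < dist a b := lt_of_not_ge fun h => hne ((hT a ha).1.eq_of_dist_le (hT b hb).1 h)
    rw [← smul_sub, norm_smul, norm_inv, Real.norm_of_nonneg hs.le, le_inv_mul_iff₀ hs, mul_one,
      ← dist_eq_norm]
    exact this.le

variable (ι s)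

/-- The point `a` has the least index among the net points at distance at most `ρ` from `x`. -/
def IsCenter (ρ : ℝ) : Config d × Eucl d × Eucl d → Prop := fun p =>
  Net ι s (p.1, p.2.2) ∧ dist p.2.1 p.2.2 ≤ ρ ∧
    ∀ b ∈ p.1.points, Net ι s (p.1, b) → dist p.2.1 b ≤ ρ → ι (p.1, p.2.2) ≤ ι (p.1, b)

/-- Two points are equivalent if they have the same center. -/
def SameCenter (ρ : ℝ) : Config d × Eucl d × Eucl d → Prop := fun p =>
  ∀ a ∈ p.1.points, IsCenter ι s ρ (p.1, p.2.1, a) ↔ IsCenter ι s ρ (p.1, p.2.2, a)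

variable {ι s}

theorem adm_sameCenter (hι : Adm d ι) (ρ : ℝ) : Adm d (SameCenter ι s ρ) := by
  have h := adm_net (s := s) hι
  have : Adm d (IsCenter ι s ρ) := by
    unfold IsCenter
    fun_prop
  unfold SameCenter
  fun_prop

theorem sameCenter_equivalence (ρ : ℝ) (S : Config d) :
    Equivalence fun x y => SameCenter ι s ρ (S, x, y) :=
  ⟨fun _ _ _ => Iff.rfl, fun h a ha => (h a ha).symm, fun h h' a ha => (h a ha).trans (h' a ha)⟩

/-- Since `s ≤ ρ`, a center exists, and the whole class lies within `ρ` of it. -/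
theorem SameCenter.finite (hs : 0 ≤ s) {ρ : ℝ} (hρ : s ≤ ρ) {S : Config d}
    (hinj : Set.InjOn (fun x => ι (S, x)) S.points) {x : Eucl d} (hx : x ∈ S.points) :
    {y ∈ S.points | SameCenter ι s ρ (S, x, y)}.Finite := by
  have hfin : {b | Net ι s (S, b) ∧ dist x b ≤ ρ}.Finite :=
    (S.finite_inter_closedBall x ρ).subset fun b hb =>
      ⟨hb.1.mem, by rw [Metric.mem_closedBall, dist_comm]; exact hb.2⟩
  obtain ⟨b, -, hxb, hb⟩ := exists_net_dist_le hs hinj hx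
  obtain ⟨a, ⟨ha, hxa⟩, hmin⟩ := Set.exists_min_image _ (fun b => ι (S, b)) hfin
    ⟨b, hb, hxb.trans hρ⟩
  have hc : IsCenter ι s ρ (S, x, a) := ⟨ha, hxa, fun b _ hb hxb => hmin b ⟨hb, hxb⟩⟩
  refine (S.finite_inter_closedBall a ρ).subset fun y hy => ⟨hy.1, ?_⟩
  exact ((hy.2 a ha.mem).1 hc).2.1

/-- If no net point has norm within `r` of `ρ`, all points of the ball of radius `r` see the same
net points at distance at most `ρ`, hence have the same center. -/
theorem exists_net_near_sphere {ρ r : ℝ} {S : Config d} {x y : Eucl d} (hx : ‖x‖ ≤ r)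
    (hy : ‖y‖ ≤ r) (h : ¬ SameCenter ι s ρ (S, x, y)) :
    ∃ a, Net ι s (S, a) ∧ |‖a‖ - ρ| ≤ r := by
  by_contra! hcon
  refine h ?_
  have key : ∀ b, Net ι s (S, b) → (dist x b ≤ ρ ↔ dist y b ≤ ρ) := by
    intro b hb
    have h1 : ∀ z : Eucl d, ‖z‖ ≤ r → (dist z b ≤ ρ ↔ ‖b‖ ≤ ρ) := by
      intro z hz
      have h2 : dist z b ≤ ‖z‖ + ‖b‖ := dist_le_norm_add_norm z b
      have h3 : ‖b‖ ≤ ‖z‖ + dist z b := by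
        rw [dist_eq_norm]
        linarith [norm_sub_norm_le b z, norm_sub_rev b z]
      have h4 := hcon b hb
      constructor
      · intro h5
        by_contra! h6
        rw [abs_of_pos (by linarith)] at h4
        linarith
      · intro h5
        rw [abs_of_nonpos (by linarith)] at h4
        linarith
    rw [h1 x hx, h1 y hy]
  intro a _
  simp only [IsCenter]
  refine and_congr_right fun ha => and_congr (key a ha) ?_
  refine forall_congr' fun b => forall_congr' fun _ => forall_congr' fun hb => ?_
  rw [key b hb]

end Net

/-! ### Averaging over radii -/

section Partition

variable {d : ℕ} {μ : Measure (Config d)} [IsProbabilityMeasure μ] {ι : Config d × Eucl d → ℝ}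

/-- The `K` candidate radii have disjoint shells, and at most `5 ^ d` net points are available to
spoil them, so some radius fails with probability at most `5 ^ d / K`. -/
theorem exists_partition (hι : Adm d ι)
    (hinj : ∀ᵐ S ∂μ, Set.InjOn (fun x => ι (S, x)) S.points) {r : ℝ} (hr : 0 < r) {ε : ℝ≥0∞}
    (hε : 0 < ε) :
    ∃ Q : Config d × Eucl d × Eucl d → Prop, Adm d Q ∧
      (∀ S, Equivalence fun x y => Q (S, x, y)) ∧
      (∀ᵐ S ∂μ, ∀ x ∈ S.points, {y ∈ S.points | Q (S, x, y)}.Finite) ∧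
      μ {S | ¬ ∀ x ∈ S.points, ∀ y ∈ S.points, dist x 0 ≤ r → dist y 0 ≤ r → Q (S, x, y)} ≤ ε := by
  obtain ⟨K, hK0, hK⟩ : ∃ K : ℕ, 0 < K ∧ ((5 ^ d : ℕ) : ℝ≥0∞) / K ≤ ε := by
    obtain ⟨K, hK⟩ := ENNReal.exists_nat_mul_gt hε.ne' (ENNReal.natCast_ne_top (5 ^ d))
    have hK0 : 0 < K := by
      rcases Nat.eq_zero_or_pos K with rfl | h
      · simp at hK
      · exact h
    exact ⟨K, hK0, ENNReal.div_le_of_le_mul (by rw [mul_comm]; exact hK.le)⟩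
  -- Radii spaced by `3 * r` have disjoint shells of half-width `r`; this `s` keeps all shells
  -- inside the ball of radius `2 * s`, where the packing bound applies.
  set s : ℝ := r * (3 * K + 2) with hs
  have hs0 : 0 < s := by positivity
  let ρ : ℕ → ℝ := fun j => s + 3 * r * j
  let A : ℕ → Config d → Prop := fun j S => ¬ ∀ x ∈ S.points, ∀ y ∈ S.points,
    dist x 0 ≤ r → dist y 0 ≤ r → SameCenter ι s (ρ j) (S, x, y)
  have hA : ∀ j, Measurable (A j) := by
    intro j
    have h := adm_sameCenter (s := s) hι (ρ j)
    have h2 : Adm d (fun q : Config d × Eucl d => ¬ ∀ x ∈ q.1.points, ∀ y ∈ q.1.points,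
      dist x q.2 ≤ r → dist y q.2 ≤ r → SameCenter ι s (ρ j) (q.1, x, y)) := by fun_prop
    exact h2.meas.comp (measurable_prodMk_right (y := (0 : Eucl d)))
  obtain ⟨j, -, hj⟩ := exists_measure_le_div μ hA hK0 (5 ^ d) (by
    refine Filter.Eventually.of_forall fun S T hT hTA => ?_
    have hex : ∀ j ∈ T, ∃ a, Net ι s (S, a) ∧ |‖a‖ - ρ j| ≤ r := by
      intro j hj
      have := hTA j hj
      simp only [A] at this
      push Not at this
      obtain ⟨x, _, y, _, hx, hy, hxy⟩ := this
      rw [dist_zero_right] at hx hy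
      exact exists_net_near_sphere hx hy hxy
    choose! a ha har using hex
    classical
    have hinjT : Set.InjOn a T := by
      intro i hi j hj hij
      have h1 := har i hi
      have h2 := har j hj
      rw [hij] at h1
      have h3 : |ρ i - ρ j| ≤ 2 * r := by
        have := abs_sub_le (ρ i) ‖a j‖ (ρ j)
        rw [abs_sub_comm (ρ i) ‖a j‖] at this
        linarith
      have h4 : ρ i - ρ j = 3 * r * ((i : ℝ) - j) := by simp only [ρ]; ring
      by_contra hne
      have h5 : (1 : ℝ) ≤ |(i : ℝ) - j| := by
        have : (1 : ℤ) ≤ |(i : ℤ) - j| := Int.one_le_abs (sub_ne_zero.2 (by exact_mod_cast hne))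
        exact_mod_cast this
      rw [h4, abs_mul, abs_of_pos (by positivity)] at h3
      nlinarith
    rw [← Finset.card_image_of_injOn hinjT]
    refine card_net_le (ι := ι) hs0 (S := S) _ fun b hb => ?_
    obtain ⟨j, hj, rfl⟩ := Finset.mem_image.1 hb
    refine ⟨ha j hj, ?_⟩
    have h1 := (abs_le.1 (har j hj)).2
    have h2 : (j : ℝ) ≤ K := by exact_mod_cast (Finset.mem_range.1 (hT hj)).le
    simp only [ρ] at h1
    nlinarith)
  refine ⟨SameCenter ι s (ρ j), adm_sameCenter hι _, sameCenter_equivalence _, ?_, hj.trans hK⟩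
  filter_upwards [hinj] with S hS x hx
  exact SameCenter.finite hs0.le (le_add_of_nonneg_right (by positivity)) hS hx

/-- An increasing sequence of equivalence relations with finite classes that join any two points. -/
theorem exists_finite_connected (hι : Adm d ι)
    (hinj : ∀ᵐ S ∂μ, Set.InjOn (fun x => ι (S, x)) S.points) :
    ∃ E : ℕ → Config d × Eucl d × Eucl d → Prop, (∀ k, Adm d (E k)) ∧
      (∀ k S, Equivalence fun x y => E k (S, x, y)) ∧
      (∀ k l, k ≤ l → ∀ p, E k p → E l p) ∧
      (∀ᵐ S ∂μ, ∀ k, ∀ x ∈ S.points, {y ∈ S.points | E k (S, x, y)}.Finite) ∧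
      (∀ᵐ S ∂μ, ∀ x ∈ S.points, ∀ y ∈ S.points, ∃ k, E k (S, x, y)) := by
  have hQ := fun n : ℕ => exists_partition (μ := μ) hι hinj (r := n + 1) (by positivity)
    (ε := (2⁻¹ : ℝ≥0∞) ^ n) (ENNReal.pow_pos (by simp) n)
  choose Q hQ heq hfin hcut using hQ
  -- Intersecting a tail makes the sequence increasing and keeps classes finite; by Borel–Cantelli
  -- any two points are eventually not separated.
  refine ⟨fun k p => ∀ j, k ≤ j → Q j p, fun k => ?_, fun k S => ?_, ?_, ?_, ?_⟩
  · exact Adm.all fun j => (Adm.const _).imp (hQ j)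
  · exact ⟨fun x j _ => (heq j S).refl x, fun h j hj => (heq j S).symm (h j hj),
      fun h h' j hj => (heq j S).trans (h j hj) (h' j hj)⟩
  · exact fun k l hkl p h j hj => h j (hkl.trans hj)
  · filter_upwards [ae_all_iff.2 hfin] with S hS k x hx
    exact (hS k x hx).subset fun y hy => ⟨hy.1, hy.2 k le_rfl⟩
  · have h := ae_eventually_of_measure_not_le μ (by simp [ENNReal.tsum_geometric]) hcut
    filter_upwards [h] with S hS x hx y hy
    obtain ⟨N, hN⟩ := Filter.eventually_atTop.1 hS
    obtain ⟨n, hn⟩ := exists_nat_ge (max (dist x 0) (dist y 0))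
    refine ⟨max N n, fun j hj => hN j ((le_max_left _ _).trans hj) x hx y hy ?_ ?_⟩
    all_goals
      have h1 : (n : ℝ) ≤ j := by exact_mod_cast (le_max_right _ _).trans hj
      have h2 := le_max_left (dist x 0) (dist y 0)
      have h3 := le_max_right (dist x 0) (dist y 0)
      linarith

end Partition

/-! ### Cutting a finite ordered set into blocks -/

/-- Hermite's identity: raising `p` by one replaces the term `p / M` by `p / M + 1`. -/
theorem sum_range_add_div (M p : ℕ) (hM : 0 < M) : ∑ t ∈ Finset.range M, (p + t) / M = p := by
  induction p with
  | zero =>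
    refine Finset.sum_eq_zero fun t ht => ?_
    rw [zero_add]
    exact Nat.div_eq_of_lt (Finset.mem_range.1 ht)
  | succ p ih =>
    have h1 := Finset.sum_range_succ (fun t => (p + t) / M) M
    have h2 := Finset.sum_range_succ' (fun t => (p + t) / M) M
    rw [ih, Nat.add_div_right p hM] at h1
    simp only [add_zero] at h2
    have h3 : ∑ t ∈ Finset.range M, (p + 1 + t) / M = ∑ t ∈ Finset.range M, (p + (t + 1)) / M :=
      Finset.sum_congr rfl fun t _ => by rw [add_assoc, add_comm 1 t]
    omega

/-- The block of length `M` that contains `p + t` lies in the interval `[t, n + t)`. -/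
def FullBlock (M t n p : ℕ) : Prop := t ≤ (p + t) / M * M ∧ ((p + t) / M + 1) * M ≤ n + t

theorem fullBlock_of_le {M t n p : ℕ} (hM : 0 < M) (h1 : M ≤ p) (h2 : p + M ≤ n) :
    FullBlock M t n p := by
  have h3 := Nat.div_add_mod (p + t) M
  have h4 := Nat.mod_lt (p + t) hM
  rw [mul_comm] at h3
  constructor
  · omega
  · rw [add_mul]
    omega

/-- Each separating shift raises the quotient by at least one, and by Hermite's identity the total
increase is `p' - p`. -/
theorem card_filter_div_lt {p p' M : ℕ} (hM : 0 < M) (h : p ≤ p') {T : Finset ℕ}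
    (hT : T ⊆ Finset.range M) (hne : ∀ t ∈ T, (p + t) / M ≠ (p' + t) / M) : T.card ≤ p' - p := by
  have hle : ∀ t, (p + t) / M ≤ (p' + t) / M := fun t => Nat.div_le_div_right (by omega)
  have h1 : ∑ t ∈ Finset.range M, (p + t) / M + T.card ≤ ∑ t ∈ Finset.range M, (p' + t) / M := by
    have h2 : T.card = ∑ t ∈ Finset.range M, if t ∈ T then 1 else 0 := by
      rw [Finset.sum_ite_mem, Finset.inter_eq_right.2 hT, Finset.card_eq_sum_ones]
    rw [h2, ← Finset.sum_add_distrib]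
    refine Finset.sum_le_sum fun t _ => ?_
    split_ifs with ht
    · exact (hle t).lt_of_ne (hne t ht)
    · exact hle t
  rw [sum_range_add_div M p hM, sum_range_add_div M p' hM] at h1
  omega

section Rank

variable {X Λ : Type*} [LinearOrder Λ] (A : Finset X) (key : X → Λ)

/-- The number of elements of `A` with a smaller key. -/
def rankIn (x : X) : ℕ := (A.filter fun z => key z < key x).card

variable {A key}

theorem rankIn_lt_card {x : X} (hx : x ∈ A) : rankIn A key x < A.card :=
  Finset.card_lt_card (Finset.filter_ssubset.2 ⟨x, hx, lt_irrefl _⟩)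

theorem rankIn_le_add {x y : X} :
    rankIn A key y ≤ rankIn A key x + (A.filter fun z => key x ≤ key z ∧ key z < key y).card := by
  classical
  refine (Finset.card_le_card ?_).trans (Finset.card_union_le _ _)
  intro z hz
  simp only [Finset.mem_filter, Finset.mem_union] at hz ⊢
  rcases lt_or_ge (key z) (key x) with h | h
  · exact Or.inl ⟨hz.1, h⟩
  · exact Or.inr ⟨hz.1, h, hz.2⟩

theorem rankIn_le_rankIn {x y : X} (h : key x ≤ key y) : rankIn A key x ≤ rankIn A key y :=
  Finset.card_le_card fun z hz => by
    simp only [Finset.mem_filter] at hz ⊢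
    exact ⟨hz.1, hz.2.trans_le h⟩

theorem rankIn_lt_rankIn {x y : X} (hx : x ∈ A) (h : key x < key y) :
    rankIn A key x < rankIn A key y :=
  Finset.card_lt_card <| Finset.ssubset_iff_subset_ne.2 ⟨fun z hz => by
    simp only [Finset.mem_filter] at hz ⊢
    exact ⟨hz.1, hz.2.trans h⟩, fun he => by
    have : x ∈ A.filter fun z => key z < key y := Finset.mem_filter.2 ⟨hx, h⟩
    rw [← he] at this
    exact lt_irrefl _ (Finset.mem_filter.1 this).2⟩

theorem rankIn_injOn (hkey : Set.InjOn key A) : Set.InjOn (rankIn A key) A := by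
  intro x hx y hy hxy
  refine hkey hx hy ?_
  rcases lt_trichotomy (key x) (key y) with h | h | h
  · exact absurd hxy (rankIn_lt_rankIn hx h).ne
  · exact h
  · exact absurd hxy (rankIn_lt_rankIn hy h).ne'

theorem image_rankIn (hkey : Set.InjOn key A) :
    A.image (rankIn A key) = Finset.range A.card := by
  refine Finset.eq_of_subset_of_card_le ?_ ?_
  · intro p hp
    obtain ⟨x, hx, rfl⟩ := Finset.mem_image.1 hp
    exact Finset.mem_range.2 (rankIn_lt_card hx)
  · rw [Finset.card_image_of_injOn (rankIn_injOn hkey), Finset.card_range]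

theorem card_filter_rankIn (hkey : Set.InjOn key A) (P : ℕ → Prop) [DecidablePred P] :
    (A.filter fun z => P (rankIn A key z)).card = ((Finset.range A.card).filter P).card := by
  rw [← image_rankIn hkey, Finset.filter_image, Finset.card_image_of_injOn]
  exact (rankIn_injOn hkey).mono fun z hz => (Finset.mem_filter.1 hz).1

/-- As `q` divides `M`, a block of length `q` lies inside one of length `M`, so it is complete when
the latter is full. -/
theorem card_block (hkey : Set.InjOn key A) {M t q w : ℕ} (hq : 0 < q) (hw : 0 < w)
    (hM : M = q * w) {p : ℕ}
    (h : FullBlock M t A.card p) :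
    (A.filter fun z => (rankIn A key z + t) / q = (p + t) / q).card = q := by
  rw [card_filter_rankIn hkey fun r => (r + t) / q = (p + t) / q]
  obtain ⟨h1, h2⟩ := h
  rw [hM, ← Nat.div_div_eq_div_mul] at h1 h2
  set c := (p + t) / q with hc
  have h3 : c / w * (q * w) ≤ c * q := by
    calc c / w * (q * w) = (c / w * w) * q := by ring
      _ ≤ c * q := Nat.mul_le_mul_right _ (Nat.div_mul_le_self _ _)
  have h4 : (c + 1) * q ≤ (c / w + 1) * (q * w) := by
    calc (c + 1) * q ≤ ((c / w + 1) * w) * q := by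
          refine Nat.mul_le_mul_right _ ?_
          have h5 := Nat.div_add_mod c w
          have h6 := Nat.mod_lt c hw
          rw [mul_comm] at h5
          rw [add_mul]
          omega
      _ = (c / w + 1) * (q * w) := by ring
  have h5 : ((Finset.range A.card).filter fun r => (r + t) / q = c) =
      Finset.Ico (c * q - t) (c * q - t + q) := by
    ext r
    simp only [Finset.mem_filter, Finset.mem_range, Finset.mem_Ico]
    rw [Nat.div_eq_iff hq]
    rw [add_mul] at h4
    omega
  rw [h5, Nat.card_Ico]
  omega

/-- Positions outside full blocks are among the first `M` or the last `M`. -/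
theorem card_not_fullBlock (hkey : Set.InjOn key A) {M t : ℕ} (hM : 0 < M) :
    ∀ B ⊆ A, (∀ z ∈ B, ¬ FullBlock M t A.card (rankIn A key z)) → B.card ≤ 2 * M := by
  intro B hB hz
  rw [← Finset.card_image_of_injOn ((rankIn_injOn hkey).mono (Finset.coe_subset.2 hB))]
  calc (B.image (rankIn A key)).card
      ≤ (Finset.range M ∪ Finset.Ico (A.card - M) A.card).card := by
        refine Finset.card_le_card fun p hp => ?_
        obtain ⟨z, hzB, rfl⟩ := Finset.mem_image.1 hp
        have h1 := rankIn_lt_card (key := key) (hB hzB)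
        have h2 : ¬ (M ≤ rankIn A key z ∧ rankIn A key z + M ≤ A.card) :=
          fun h => hz z hzB (fullBlock_of_le hM h.1 h.2)
        simp only [Finset.mem_union, Finset.mem_range, Finset.mem_Ico]
        omega
    _ ≤ M + M := by
        refine (Finset.card_union_le _ _).trans ?_
        rw [Finset.card_range, Nat.card_Ico]
        omega
    _ = 2 * M := by ring

end Rank

/-! ### Partitions into classes of equal size -/

section EqParts

variable {X : Type*}

/-- The relation `r` is an equivalence relation on `V` all of whose classes have `q` elements. -/
structure EqParts (V : Set X) (r : X → X → Prop) (q : ℕ) : Prop where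
  refl : ∀ x ∈ V, r x x
  symm : ∀ x ∈ V, ∀ y ∈ V, r x y → r y x
  trans : ∀ x ∈ V, ∀ y ∈ V, ∀ z ∈ V, r x y → r y z → r x z
  card : ∀ x ∈ V, {y | y ∈ V ∧ r x y}.ncard = q

variable {V R : Set X} {r K : X → X → Prop} {q q' : ℕ}

theorem EqParts.finite (h : EqParts V r q) (hq : 0 < q) {x : X} (hx : x ∈ V) :
    {y | y ∈ V ∧ r x y}.Finite :=
  Set.finite_of_ncard_ne_zero (by rw [h.card x hx]; exact hq.ne')

/-- Each class of representatives stands for `q'` disjoint classes of size `q`. -/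
theorem EqParts.lift (h : EqParts V r q) (hq : 0 < q) (hR : R ⊆ V)
    (hex : ∀ x ∈ V, ∃ a ∈ R, r x a) (huniq : ∀ a ∈ R, ∀ b ∈ R, r a b → a = b)
    (hK : EqParts R K q') (hq' : 0 < q') :
    EqParts V (fun x y => ∃ a ∈ R, ∃ b ∈ R, r x a ∧ r y b ∧ K a b) (q' * q) := by
  classical
  have huniq' : ∀ x ∈ V, ∀ a ∈ R, ∀ b ∈ R, r x a → r x b → a = b := fun x hx a ha b hb h1 h2 =>
    huniq a ha b hb (h.trans a (hR ha) x hx b (hR hb) (h.symm x hx a (hR ha) h1) h2)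
  refine ⟨fun x hx => ?_, ?_, ?_, fun x hx => ?_⟩
  · obtain ⟨a, ha, hxa⟩ := hex x hx
    exact ⟨a, ha, a, ha, hxa, hxa, hK.refl a ha⟩
  · rintro x hx y hy ⟨a, ha, b, hb, hxa, hyb, hab⟩
    exact ⟨b, hb, a, ha, hyb, hxa, hK.symm a ha b hb hab⟩
  · rintro x hx y hy z hz ⟨a, ha, b, hb, hxa, hyb, hab⟩ ⟨b', hb', c, hc, hyb', hzc, hbc⟩
    obtain rfl := huniq' y hy b hb b' hb' hyb hyb'
    exact ⟨a, ha, c, hc, hxa, hzc, hK.trans a ha b hb c hc hab hbc⟩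
  · obtain ⟨a, ha, hxa⟩ := hex x hx
    have hB := hK.finite hq' ha
    have hcls : ∀ b ∈ R, ∃ T : Finset X, T.card = q ∧ ∀ y, y ∈ T ↔ y ∈ V ∧ r b y := by
      intro b hb
      have hf := h.finite hq (hR hb)
      refine ⟨hf.toFinset, ?_, fun y => by simp⟩
      rw [← Set.ncard_eq_toFinset_card _ hf, h.card b (hR hb)]
    choose! T hTc hT using hcls
    have hset : {y | y ∈ V ∧ ∃ a ∈ R, ∃ b ∈ R, r x a ∧ r y b ∧ K a b} =
        ((hB.toFinset.biUnion T : Finset X) : Set X) := by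
      ext y
      simp only [Set.mem_ofPred_eq, Finset.coe_biUnion, Set.Finite.coe_toFinset, Set.mem_iUnion,
        exists_prop]
      constructor
      · rintro ⟨hy, a', ha', b, hb, hxa', hyb, hab⟩
        obtain rfl := huniq' x hx a ha a' ha' hxa hxa'
        exact ⟨b, ⟨hb, hab⟩, (hT b hb y).2 ⟨hy, h.symm y hy b (hR hb) hyb⟩⟩
      · rintro ⟨b, ⟨hb, hab⟩, hyb⟩
        have := (hT b hb y).1 hyb
        exact ⟨this.1, a, ha, b, hb, hxa, h.symm b (hR hb) y this.1 this.2, hab⟩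
    rw [hset, Set.ncard_coe_finset, Finset.card_biUnion]
    · rw [Finset.sum_congr rfl fun b hb => hTc b (hB.mem_toFinset.1 hb).1, Finset.sum_const,
        smul_eq_mul, ← Set.ncard_eq_toFinset_card _ hB, hK.card a ha]
    · intro b hb c hc hbc
      have hb' := (hB.mem_toFinset.1 hb).1
      have hc' := (hB.mem_toFinset.1 hc).1
      refine Finset.disjoint_left.2 fun y hyb hyc => hbc ?_
      have h1 := (hT b hb' y).1 hyb
      have h2 := (hT c hc' y).1 hyc
      exact huniq b hb' c hc' (h.trans b (hR hb') y h1.1 c (hR hc') h1.2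
        (h.symm c (hR hc') y h1.1 h2.2))

end EqParts

/-! ### Cutting the classes of a relation into blocks -/

section Chunk

variable {d : ℕ}

/-- The point has the least index in its class. -/
def IsRep (ι : Config d × Eucl d → ℝ) (D : Config d × Eucl d × Eucl d → Prop) :
    Config d × Eucl d → Prop := fun p =>
  p.2 ∈ p.1.points ∧ ∀ y ∈ p.1.points, D (p.1, p.2, y) → ι p ≤ ι (p.1, y)

/-- The classes of `E` are ordered by their least indices, the points of a class by their
indices. -/
def Before (ι : Config d × Eucl d → ℝ) (E : Config d × Eucl d × Eucl d → Prop) :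
    Config d × Eucl d × Eucl d → Prop := fun p =>
  (E p ∧ ι (p.1, p.2.1) < ι (p.1, p.2.2)) ∨ (¬ E p ∧ ∃ z ∈ p.1.points, E (p.1, p.2.1, z) ∧
    ∀ w ∈ p.1.points, E (p.1, p.2.2, w) → ι (p.1, z) < ι (p.1, w))

/-- The number of points of `U` in the `E`-class of a point. -/
noncomputable def classSize (U : Config d × Eucl d → Prop)
    (E : Config d × Eucl d × Eucl d → Prop) : Config d × Eucl d → ℕ := fun p =>
  {z | z ∈ p.1.points ∧ U (p.1, z) ∧ E (p.1, p.2, z)}.ncard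

/-- The number of points of `U` in the `E`-class of a point that come before it. -/
noncomputable def classPos (U : Config d × Eucl d → Prop)
    (E L : Config d × Eucl d × Eucl d → Prop) : Config d × Eucl d → ℕ := fun p =>
  {z | z ∈ p.1.points ∧ U (p.1, z) ∧ E (p.1, p.2, z) ∧ L (p.1, z, p.2)}.ncard

/-- The point lies in a full block of length `M` of its class. -/
def InFull (U : Config d × Eucl d → Prop) (E L : Config d × Eucl d × Eucl d → Prop) (M t : ℕ) :
    Config d × Eucl d → Prop := fun p => FullBlock M t (classSize U E p) (classPos U E L p)

/-- Two points lie in the same block of length `q` inside a full block of length `M`. -/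
def SameBlock (U : Config d × Eucl d → Prop) (E L : Config d × Eucl d × Eucl d → Prop)
    (M t q : ℕ) : Config d × Eucl d × Eucl d → Prop := fun p =>
  U (p.1, p.2.1) ∧ U (p.1, p.2.2) ∧ E p ∧ InFull U E L M t (p.1, p.2.1) ∧
    (classPos U E L (p.1, p.2.1) + t) / q = (classPos U E L (p.1, p.2.2) + t) / q

/-- The points that do not lie in full blocks of the first `k` relations. -/
def Leftover (U : Config d × Eucl d → Prop) (E : ℕ → Config d × Eucl d × Eucl d → Prop)
    (L : Config d × Eucl d × Eucl d → Prop) (M t : ℕ) : ℕ → Config d × Eucl d → Prop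
  | 0 => U
  | k + 1 => fun p => Leftover U E L M t k p ∧ ¬ InFull (Leftover U E L M t k) (E k) L M t p

/-- Two points lie in the same block at one of the steps. -/
def Blocks (U : Config d × Eucl d → Prop) (E : ℕ → Config d × Eucl d × Eucl d → Prop)
    (L : Config d × Eucl d × Eucl d → Prop) (M t q : ℕ) : Config d × Eucl d × Eucl d → Prop :=
  fun p => ∃ k, SameBlock (Leftover U E L M t k) (E k) L M t q p

section Adm

variable {ι : Config d × Eucl d → ℝ} {U : Config d × Eucl d → Prop}
  {D E₀ L : Config d × Eucl d × Eucl d → Prop} {E : ℕ → Config d × Eucl d × Eucl d → Prop}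
  {M t q : ℕ}

theorem adm_isRep (hι : Adm d ι) (hD : Adm d D) : Adm d (IsRep ι D) := by
  unfold IsRep
  fun_prop

theorem adm_before (hι : Adm d ι) (hE : Adm d E₀) : Adm d (Before ι E₀) := by
  unfold Before
  fun_prop

theorem adm_classSize (hU : Adm d U) (hE : Adm d E₀) : Adm d (classSize U E₀) := by
  unfold classSize
  fun_prop

theorem adm_classPos (hU : Adm d U) (hE : Adm d E₀) (hL : Adm d L) :
    Adm d (classPos U E₀ L) := by
  unfold classPos
  fun_prop

theorem adm_inFull (hU : Adm d U) (hE : Adm d E₀) (hL : Adm d L) :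
    Adm d (InFull U E₀ L M t) :=
  Adm.trivComp₂ (h := FullBlock M t) (measurable_of_countable _) (adm_classSize hU hE)
    (adm_classPos hU hE hL)

theorem adm_sameBlock (hU : Adm d U) (hE : Adm d E₀) (hL : Adm d L) :
    Adm d (SameBlock U E₀ L M t q) := by
  have h1 := adm_inFull (M := M) (t := t) hU hE hL
  have h2 := adm_classPos hU hE hL
  unfold SameBlock
  fun_prop

theorem adm_leftover (hU : Adm d U) (hE : ∀ k, Adm d (E k)) (hL : Adm d L) (k : ℕ) :
    Adm d (Leftover U E L M t k) := by
  induction k with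
  | zero => exact hU
  | succ k ih => exact ih.and (adm_inFull ih (hE k) hL).not

theorem adm_blocks (hU : Adm d U) (hE : ∀ k, Adm d (E k)) (hL : Adm d L) :
    Adm d (Blocks U E L M t q) :=
  Adm.ex fun k => adm_sameBlock (adm_leftover hU hE hL k) (hE k) hL

end Adm

section Config

variable {S : Config d} {ι : Config d × Eucl d → ℝ}

/-- Comparing lexicographically the least index of the class, then the own index, turns `Before`
into a linear order in which every class is an interval. -/
theorem exists_key {E : Config d × Eucl d × Eucl d → Prop}
    (hinj : Set.InjOn (fun x => ι (S, x)) S.points) (hE : Equivalence fun x y => E (S, x, y))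
    (hfin : ∀ x ∈ S.points, {y ∈ S.points | E (S, x, y)}.Finite) :
    ∃ key : Eucl d → Lex (ℝ × ℝ), Set.InjOn key S.points ∧
      (∀ x ∈ S.points, ∀ y ∈ S.points, Before ι E (S, x, y) ↔ key x < key y) ∧
      ∀ x ∈ S.points, ∀ y ∈ S.points, ∀ z ∈ S.points, E (S, x, y) → key x ≤ key z →
        key z ≤ key y → E (S, x, z) := by
  have hmin : ∀ x ∈ S.points, ∃ m ∈ S.points, E (S, x, m) ∧
      ∀ y ∈ S.points, E (S, x, y) → ι (S, m) ≤ ι (S, y) := by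
    intro x hx
    obtain ⟨m, hm, h⟩ := Set.exists_min_image _ (fun y => ι (S, y)) (hfin x hx)
      ⟨x, hx, hE.refl x⟩
    exact ⟨m, hm.1, hm.2, fun y hy hxy => h y ⟨hy, hxy⟩⟩
  choose! m hm hEm hle using hmin
  have hiff : ∀ x ∈ S.points, ∀ y ∈ S.points, E (S, x, y) ↔ ι (S, m x) = ι (S, m y) := by
    intro x hx y hy
    constructor
    · intro h
      exact le_antisymm (hle x hx _ (hm y hy) (hE.trans h (hEm y hy)))
        (hle y hy _ (hm x hx) (hE.trans (hE.symm h) (hEm x hx)))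
    · intro h
      have := hinj (hm x hx) (hm y hy) h
      exact hE.trans (hEm x hx) (this ▸ hE.symm (hEm y hy))
  refine ⟨fun x => toLex (ι (S, m x), ι (S, x)), ?_, ?_, ?_⟩
  · intro x hx y hy h
    exact hinj hx hy (Prod.ext_iff.1 (toLex.injective h)).2
  · intro x hx y hy
    rw [Prod.Lex.toLex_lt_toLex]
    simp only [Before, hiff x hx y hy]
    constructor
    · rintro (h | ⟨-, z, hz, hxz, h⟩)
      · exact Or.inr h
      · exact Or.inl ((hle x hx z hz hxz).trans_lt (h _ (hm y hy) (hEm y hy)))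
    · rintro (h | h)
      · exact Or.inr ⟨h.ne, m x, hm x hx, hEm x hx, fun w hw hyw => h.trans_le (hle y hy w hw hyw)⟩
      · exact Or.inl h
  · intro x hx y hy z hz hxy h1 h2
    rw [Prod.Lex.toLex_le_toLex] at h1 h2
    rw [hiff x hx y hy] at hxy
    rw [hiff x hx z hz]
    simp only at h1 h2
    rcases h1 with h1 | h1
    · rcases h2 with h2 | h2
      · exact absurd (hxy ▸ h1.trans h2) (lt_irrefl _)
      · rw [hxy, h2.1]
    · exact h1.1

theorem isRep_exists {D : Config d × Eucl d × Eucl d → Prop} {q : ℕ} (hq : 0 < q)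
    (hD : EqParts S.points (fun x y => D (S, x, y)) q) {x : Eucl d} (hx : x ∈ S.points) :
    ∃ a ∈ {a | IsRep ι D (S, a)}, D (S, x, a) := by
  obtain ⟨m, hm, h⟩ := Set.exists_min_image _ (fun y => ι (S, y)) (hD.finite hq hx)
    ⟨x, hx, hD.refl x hx⟩
  exact ⟨m, ⟨hm.1, fun y hy hmy => h y ⟨hy, hD.trans x hx m hm.1 y hy hm.2 hmy⟩⟩, hm.2⟩

theorem isRep_unique {D : Config d × Eucl d × Eucl d → Prop} {q : ℕ}
    (hinj : Set.InjOn (fun x => ι (S, x)) S.points)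
    (hD : EqParts S.points (fun x y => D (S, x, y)) q) :
    ∀ a ∈ {a | IsRep ι D (S, a)}, ∀ b ∈ {a | IsRep ι D (S, a)}, D (S, a, b) → a = b :=
  fun a ha b hb h => hinj ha.1 hb.1 (le_antisymm (ha.2 b hb.1 h)
    (hb.2 a ha.1 (hD.symm a ha.1 b hb.1 h)))

variable {Λ : Type*} [LinearOrder Λ] {key : Eucl d → Λ}

section One

variable {U : Config d × Eucl d → Prop} {E L : Config d × Eucl d × Eucl d → Prop} {M t q w : ℕ}

theorem exists_class_finset (hE : Equivalence fun x y => E (S, x, y))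
    (hfin : ∀ x ∈ S.points, {y ∈ S.points | E (S, x, y)}.Finite)
    (hL : ∀ x ∈ S.points, ∀ y ∈ S.points, L (S, x, y) ↔ key x < key y)
    {x : Eucl d} (hx : x ∈ S.points) :
    ∃ A : Finset (Eucl d), (∀ z, z ∈ A ↔ z ∈ S.points ∧ U (S, z) ∧ E (S, x, z)) ∧
      ∀ y ∈ S.points, E (S, x, y) →
        classSize U E (S, y) = A.card ∧ classPos U E L (S, y) = rankIn A key y := by
  have hf : {z | z ∈ S.points ∧ U (S, z) ∧ E (S, x, z)}.Finite :=
    (hfin x hx).subset fun z hz => ⟨hz.1, hz.2.2⟩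
  refine ⟨hf.toFinset, fun z => by rw [Set.Finite.mem_toFinset, Set.mem_ofPred_eq],
    fun y hy hxy => ?_⟩
  have hiff : ∀ z, E (S, y, z) ↔ E (S, x, z) := fun z =>
    ⟨fun h => hE.trans hxy h, fun h => hE.trans (hE.symm hxy) h⟩
  constructor
  · rw [← Set.ncard_eq_toFinset_card _ hf]
    simp only [classSize, hiff]
  · rw [rankIn, ← Set.ncard_coe_finset]
    simp only [classPos, hiff]
    congr 1
    ext z
    simp only [Set.mem_ofPred_eq, Finset.coe_filter, Set.Finite.mem_toFinset]
    constructor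
    · rintro ⟨h1, h2, h3, h4⟩
      exact ⟨⟨h1, h2, h3⟩, (hL z h1 y hy).1 h4⟩
    · rintro ⟨⟨h1, h2, h3⟩, h4⟩
      exact ⟨h1, h2, h3, (hL z h1 y hy).2 h4⟩

/-- The definition asks fullness only of the first point; since `q` divides `M`, the second lies in
the same block of length `M`. -/
theorem SameBlock.inFull (hE : Equivalence fun x y => E (S, x, y)) (hM : M = q * w)
    {x y : Eucl d} (h : SameBlock U E L M t q (S, x, y)) : InFull U E L M t (S, y) := by
  obtain ⟨-, -, hxy, hf, hq⟩ := h
  have hiff : ∀ z, E (S, y, z) ↔ E (S, x, z) := fun z =>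
    ⟨fun h => hE.trans hxy h, fun h => hE.trans (hE.symm hxy) h⟩
  have hsz : classSize U E (S, y) = classSize U E (S, x) := by simp only [classSize, hiff]
  simp only at hq
  rw [InFull, FullBlock, hsz, hM, ← Nat.div_div_eq_div_mul, ← hq, Nat.div_div_eq_div_mul, ← hM]
  exact hf

theorem ncard_sameBlock (hE : Equivalence fun x y => E (S, x, y))
    (hfin : ∀ x ∈ S.points, {y ∈ S.points | E (S, x, y)}.Finite)
    (hL : ∀ x ∈ S.points, ∀ y ∈ S.points, L (S, x, y) ↔ key x < key y)
    (hkey : Set.InjOn key S.points) (hq : 0 < q) (hw : 0 < w) (hM : M = q * w)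
    {x : Eucl d} (hx : x ∈ S.points) (hU : U (S, x)) (hf : InFull U E L M t (S, x)) :
    {y | y ∈ S.points ∧ SameBlock U E L M t q (S, x, y)}.ncard = q := by
  obtain ⟨A, hA, hA'⟩ := exists_class_finset (U := U) hE hfin hL hx
  have hf' := hf
  have hx' := hA' x hx (hE.refl x)
  rw [InFull, hx'.1, hx'.2] at hf'
  have hkA : Set.InjOn key A := hkey.mono fun z hz => ((hA z).1 hz).1
  refine Eq.trans ?_ (card_block hkA hq hw hM hf')
  rw [← Set.ncard_coe_finset]
  congr 1
  ext y
  simp only [Set.mem_ofPred_eq, Finset.coe_filter, hA, SameBlock]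
  constructor
  · rintro ⟨hy, -, hUy, hxy, -, h⟩
    rw [hx'.2, (hA' y hy hxy).2] at h
    exact ⟨⟨hy, hUy, hxy⟩, h.symm⟩
  · rintro ⟨⟨hy, hUy, hxy⟩, h⟩
    refine ⟨hy, hU, hUy, hxy, hf, ?_⟩
    rw [hx'.2, (hA' y hy hxy).2, h]

end One

section Seq

variable {U : Config d × Eucl d → Prop} {L : Config d × Eucl d × Eucl d → Prop}
  {E : ℕ → Config d × Eucl d × Eucl d → Prop} {M t q w : ℕ}

theorem Leftover.mono {k l : ℕ} (hkl : k ≤ l) {p : Config d × Eucl d}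
    (h : Leftover U E L M t l p) : Leftover U E L M t k p := by
  induction l, hkl using Nat.le_induction with
  | base => exact h
  | succ l _ ih => exact ih h.1

theorem Leftover.level_unique {k l : ℕ} {p : Config d × Eucl d}
    (hk : Leftover U E L M t k p) (hkf : InFull (Leftover U E L M t k) (E k) L M t p)
    (hl : Leftover U E L M t l p) (hlf : InFull (Leftover U E L M t l) (E l) L M t p) : k = l := by
  rcases lt_trichotomy k l with h | h | h
  · exact absurd hkf (hl.mono (Nat.succ_le_of_lt h)).2
  · exact h
  · exact absurd hlf (hk.mono (Nat.succ_le_of_lt h)).2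

theorem eventually_common_class (hmono : ∀ k l, k ≤ l → ∀ p, E k p → E l p)
    (hconn : ∀ x ∈ S.points, ∀ y ∈ S.points, ∃ k, E k (S, x, y)) {T : Set (Eucl d)}
    (hT : T.Finite) (hTS : T ⊆ S.points) :
    ∀ᶠ k in Filter.atTop, ∀ x ∈ T, ∀ y ∈ T, E k (S, x, y) := by
  rw [Filter.eventually_all_finite hT]
  intro x hx
  rw [Filter.eventually_all_finite hT]
  intro y hy
  obtain ⟨k, hk⟩ := hconn x (hTS hx) y (hTS hy)
  exact Filter.eventually_atTop.2 ⟨k, fun l hl => hmono k l hl _ hk⟩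

/-- Otherwise `2 * M + 1` points that are never used would share a class of some `E k`, which leaves
at most `2 * M` points outside full blocks. -/
theorem finite_leftover (hE : ∀ k, Equivalence fun x y => E k (S, x, y))
    (hmono : ∀ k l, k ≤ l → ∀ p, E k p → E l p)
    (hfin : ∀ k, ∀ x ∈ S.points, {y ∈ S.points | E k (S, x, y)}.Finite)
    (hconn : ∀ x ∈ S.points, ∀ y ∈ S.points, ∃ k, E k (S, x, y))
    (hL : ∀ x ∈ S.points, ∀ y ∈ S.points, L (S, x, y) ↔ key x < key y)
    (hkey : Set.InjOn key S.points) (hM : 0 < M) :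
    {x ∈ S.points | ∀ k, Leftover U E L M t k (S, x)}.Finite := by
  by_contra hinf
  obtain ⟨T, hT, hTc⟩ := Set.Infinite.exists_subset_card_eq hinf (2 * M + 1)
  obtain ⟨k, hk⟩ := (eventually_common_class hmono hconn T.finite_toSet
    (hT.trans (Set.sep_subset _ _))).exists
  obtain ⟨x, hxT⟩ : T.Nonempty := Finset.card_pos.1 (by omega)
  have hx := hT hxT
  obtain ⟨A, hA, hA'⟩ := exists_class_finset (U := Leftover U E L M t k) (hE k) (hfin k) hL hx.1
  have hkA : Set.InjOn key A := hkey.mono fun z hz => ((hA z).1 hz).1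
  have := card_not_fullBlock (t := t) hkA hM T
    (fun y hy => (hA y).2 ⟨(hT hy).1, (hT hy).2 k, hk x hxT y hy⟩)
    (fun y hy hf => by
      have h1 := hA' y (hT hy).1 (hk x hxT y hy)
      rw [← h1.1, ← h1.2] at hf
      exact ((hT hy).2 (k + 1)).2 hf)
  omega

theorem eqParts_blocks (hE : ∀ k, Equivalence fun x y => E k (S, x, y))
    (hfin : ∀ k, ∀ x ∈ S.points, {y ∈ S.points | E k (S, x, y)}.Finite)
    (hL : ∀ x ∈ S.points, ∀ y ∈ S.points, L (S, x, y) ↔ key x < key y)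
    (hkey : Set.InjOn key S.points) (hUS : ∀ x, U (S, x) → x ∈ S.points)
    (hcov : ∀ x ∈ S.points, ¬ ∀ k, Leftover U E L M t k (S, x))
    (hq : 0 < q) (hw : 0 < w) (hM : M = q * w) :
    EqParts {x | U (S, x)} (fun x y => Blocks U E L M t q (S, x, y)) q := by
  have hlev : ∀ x, U (S, x) → ∃ k, Leftover U E L M t k (S, x) ∧
      InFull (Leftover U E L M t k) (E k) L M t (S, x) := by
    intro x hx
    by_contra! hcon
    refine hcov x (hUS x hx) fun k => ?_
    induction k with
    | zero => exact hx
    | succ k ih => exact ⟨ih, hcon k ih⟩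
  refine ⟨fun x hx => ?_, ?_, ?_, fun x hx => ?_⟩
  · obtain ⟨k, hk, hkf⟩ := hlev x hx
    exact ⟨k, hk, hk, (hE k).refl x, hkf, rfl⟩
  · rintro x hx y hy ⟨k, h⟩
    have hf := h.inFull (hE k) hM
    obtain ⟨h1, h2, h3, -, h4⟩ := h
    exact ⟨k, h2, h1, (hE k).symm h3, hf, h4.symm⟩
  · rintro x hx y hy z hz ⟨k, h⟩ ⟨l, h'⟩
    obtain rfl := h.2.1.level_unique (h.inFull (hE k) hM) h'.1 h'.2.2.2.1
    exact ⟨k, h.1, h'.2.1, (hE k).trans h.2.2.1 h'.2.2.1, h.2.2.2.1,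
      h.2.2.2.2.trans h'.2.2.2.2⟩
  · obtain ⟨k, hk, hkf⟩ := hlev x hx
    refine Eq.trans ?_ (ncard_sameBlock (hE k) (hfin k) hL hkey hq hw hM (hUS x hx) hk hkf)
    congr 1
    ext y
    constructor
    · rintro ⟨hy, l, h⟩
      obtain rfl := h.1.level_unique h.2.2.2.1 hk hkf
      exact ⟨hUS y hy, h⟩
    · rintro ⟨hy, h⟩
      exact ⟨h.2.1.mono (Nat.zero_le k), k, h⟩

theorem Blocks.mono {q' : ℕ} (hq : q ∣ q') {p : Config d × Eucl d × Eucl d}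
    (h : Blocks U E L M t q p) : Blocks U E L M t q' p := by
  obtain ⟨k, h1, h2, h3, h4, h5⟩ := h
  obtain ⟨c, rfl⟩ := hq
  refine ⟨k, h1, h2, h3, h4, ?_⟩
  rw [← Nat.div_div_eq_div_mul, ← Nat.div_div_eq_div_mul, h5]

end Seq

end Config

end Chunk

/-! ### Extending a partition into classes of equal size -/

section Extension

variable {d : ℕ} {ι : Config d × Eucl d → ℝ} {E : ℕ → Config d × Eucl d × Eucl d → Prop}
  {D : Config d × Eucl d × Eucl d → Prop} {S : Config d}

/-- The indices of the points of `S` are distinct, and the relations `E k` form an increasing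
sequence of equivalence relations with finite classes that join any two points of `S`. -/
structure Generic (ι : Config d × Eucl d → ℝ) (E : ℕ → Config d × Eucl d × Eucl d → Prop)
    (S : Config d) : Prop where
  inj : Set.InjOn (fun x => ι (S, x)) S.points
  equiv : ∀ k, Equivalence fun x y => E k (S, x, y)
  mono : ∀ k l, k ≤ l → ∀ p, E k p → E l p
  fin : ∀ k, ∀ x ∈ S.points, {y ∈ S.points | E k (S, x, y)}.Finite
  conn : ∀ x ∈ S.points, ∀ y ∈ S.points, ∃ k, E k (S, x, y)

theorem Generic.shift (h : Generic ι E S) (n : ℕ) : Generic ι (fun k => E (n + k)) S where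
  inj := h.inj
  equiv k := h.equiv _
  mono k l hkl := h.mono _ _ (by omega)
  fin k := h.fin _
  conn x hx y hy := by
    obtain ⟨k, hk⟩ := h.conn x hx y hy
    exact ⟨k, h.mono _ _ (by omega) _ hk⟩

/-- The point `a` is the representative of a class that meets the ball of radius `r` around
`u`. -/
def RepNear (ι : Config d × Eucl d → ℝ) (D : Config d × Eucl d × Eucl d → Prop) (r : ℝ) :
    Config d × Eucl d × Eucl d → Prop := fun p =>
  IsRep ι D (p.1, p.2.2) ∧ ∃ x ∈ p.1.points, dist x p.2.1 ≤ r ∧ D (p.1, x, p.2.2)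

theorem adm_repNear (hι : Adm d ι) (hD : Adm d D) (r : ℝ) : Adm d (RepNear ι D r) := by
  have := adm_isRep hι hD
  unfold RepNear
  fun_prop

theorem finite_repNear {q : ℕ} (hq : 0 < q) (hD : EqParts S.points (fun x y => D (S, x, y)) q)
    (u : Eucl d) (r : ℝ) : {a | RepNear ι D r (S, u, a)}.Finite := by
  refine ((S.finite_inter_closedBall u r).biUnion (t := fun x => {a | a ∈ S.points ∧ D (S, x, a)})
    fun x hx => hD.finite hq hx.1).subset ?_
  rintro a ⟨ha, x, hx, hxu, hxa⟩
  exact Set.mem_biUnion ⟨hx, hxu⟩ ⟨ha.1, hxa⟩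

theorem infinite_above {Λ : Type*} [LinearOrder Λ] {V : Set (Eucl d)} {key : Eucl d → Λ}
    (hmax : ∀ x ∈ V, ∃ y ∈ V, key x < key y) {a : Eucl d} (ha : a ∈ V) :
    {b ∈ V | key a < key b}.Infinite := by
  intro hfin
  obtain ⟨b, hb, hab⟩ := hmax a ha
  obtain ⟨c, ⟨hc, hac⟩, hmx⟩ := Set.exists_max_image _ key hfin ⟨b, hb, hab⟩
  obtain ⟨e, he, hce⟩ := hmax c hc
  exact (hmx e ⟨he, hac.trans hce⟩).not_gt hce

variable {μ : Measure (Config d)} [IsProbabilityMeasure μ]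

/-- A last point would be unique, hence an equivariantly selected finite nonempty set. -/
theorem ae_no_extremal (hd : 1 ≤ d) (hinv : IsometryInvariant μ) {U : Config d × Eucl d → Prop}
    {L : Config d × Eucl d × Eucl d → Prop} (hU : Adm d U) (hL : Adm d L)
    (htri : ∀ᵐ S ∂μ, ∀ x ∈ S.points, ∀ y ∈ S.points, x = y ∨ L (S, x, y) ∨ L (S, y, x)) :
    ∀ᵐ S ∂μ, ∀ x ∈ S.points, U (S, x) → ∃ y ∈ S.points, U (S, y) ∧ L (S, x, y) := by
  have hA : Adm d (fun p : Config d × Eucl d => U p ∧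
      ∀ y ∈ p.1.points, U (p.1, y) → ¬ L (p.1, p.2, y)) := by fun_prop
  filter_upwards [ae_infinite_of_nonempty hd hinv hA, htri] with S hS htri x hx hUx
  by_contra! hcon
  refine hS (Set.Subsingleton.finite ?_) x hx ⟨hUx, hcon⟩
  rintro a ⟨ha, hUa, ha'⟩ b ⟨hb, hUb, hb'⟩
  rcases htri a ha b hb with h | h | h
  · exact h
  · exact (ha' b hb hUb h).elim
  · exact (hb' a ha hUa h).elim

/-- Without extremal points there are infinitely many points on either side of `a`; `M` from each
side eventually join its class. -/
theorem eventually_deep {U : Config d × Eucl d → Prop} {L : Config d × Eucl d × Eucl d → Prop}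
    {Λ : Type*} [LinearOrder Λ] {key : Eucl d → Λ} (hS : Generic ι E S)
    (hL : ∀ x ∈ S.points, ∀ y ∈ S.points, L (S, x, y) ↔ key x < key y)
    (hmax : ∀ x ∈ S.points, U (S, x) → ∃ y ∈ S.points, U (S, y) ∧ L (S, x, y))
    (hmin : ∀ x ∈ S.points, U (S, x) → ∃ y ∈ S.points, U (S, y) ∧ L (S, y, x))
    (M : ℕ) {a : Eucl d} (ha : a ∈ S.points) (hUa : U (S, a)) :
    ∀ᶠ k in Filter.atTop, M ≤ classPos U (E k) L (S, a) ∧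
      classPos U (E k) L (S, a) + M ≤ classSize U (E k) (S, a) := by
  classical
  have h1 := infinite_above (V := {x | x ∈ S.points ∧ U (S, x)}) (key := key)
    (fun x hx => by
      obtain ⟨y, hy, hUy, hxy⟩ := hmax x hx.1 hx.2
      exact ⟨y, ⟨hy, hUy⟩, (hL x hx.1 y hy).1 hxy⟩) ⟨ha, hUa⟩
  have h2 := infinite_above (V := {x | x ∈ S.points ∧ U (S, x)}) (key := OrderDual.toDual ∘ key)
    (fun x hx => by
      obtain ⟨y, hy, hUy, hxy⟩ := hmin x hx.1 hx.2
      exact ⟨y, ⟨hy, hUy⟩, (hL y hy x hx.1).1 hxy⟩) ⟨ha, hUa⟩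
  obtain ⟨T₁, hT₁, hc₁⟩ := h1.exists_subset_card_eq M
  obtain ⟨T₂, hT₂, hc₂⟩ := h2.exists_subset_card_eq M
  filter_upwards [eventually_common_class hS.mono hS.conn (T := insert a (T₁ ∪ T₂ : Set (Eucl d)))
    (((T₁.finite_toSet).union T₂.finite_toSet).insert a) (by
      rintro x (rfl | hx | hx)
      · exact ha
      · exact (hT₁ hx).1.1
      · exact (hT₂ hx).1.1)] with k hk
  obtain ⟨A, hA, hA'⟩ := exists_class_finset (U := U) (hS.equiv k) (hS.fin k) hL ha
  obtain ⟨hsz, hps⟩ := hA' a ha ((hS.equiv k).refl a)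
  rw [hsz, hps]
  constructor
  · rw [← hc₂]
    refine Finset.card_le_card fun z hz => Finset.mem_filter.2 ⟨(hA z).2 ⟨(hT₂ hz).1.1,
      (hT₂ hz).1.2, hk a (by simp) z (by simp [hz])⟩, (hT₂ hz).2⟩
  · rw [rankIn, ← hc₁, ← Finset.card_union_of_disjoint]
    · refine Finset.card_le_card (Finset.union_subset (Finset.filter_subset _ _) fun z hz => ?_)
      exact (hA z).2 ⟨(hT₁ hz).1.1, (hT₁ hz).1.2, hk a (by simp) z (by simp [hz])⟩
    · refine Finset.disjoint_left.2 fun z hz hz' => ?_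
      exact lt_asymm (Finset.mem_filter.1 hz).2 (hT₁ hz').2

/-- The set `V` lies in one class of `E k`, an interval of the order with at most `N` points of `U`.
So inside the larger class of `E l` its extreme positions differ by at most `N`, and each unit of
difference accounts for one bad shift. -/
theorem card_bad_shift_le {U : Config d × Eucl d → Prop} {L : Config d × Eucl d × Eucl d → Prop}
    {Λ : Type*} [LinearOrder Λ] {key : Eucl d → Λ} (hS : Generic ι E S)
    (hL : ∀ x ∈ S.points, ∀ y ∈ S.points, L (S, x, y) ↔ key x < key y) {k l : ℕ} (hkl : k ≤ l)
    (hconv : ∀ x ∈ S.points, ∀ y ∈ S.points, ∀ z ∈ S.points, E k (S, x, y) → key x ≤ key z →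
        key z ≤ key y → E k (S, x, z)) {V : Set (Eucl d)} (hV : V.Finite)
    (hVU : ∀ a ∈ V, a ∈ S.points ∧ U (S, a)) (hVE : ∀ a ∈ V, ∀ b ∈ V, E k (S, a, b)) {N : ℕ}
    (hN : ∀ a ∈ V, classSize U (E k) (S, a) ≤ N) {M : ℕ} (hM : 0 < M) {T : Finset ℕ}
    (hT : T ⊆ Finset.range M)
    (hbad : ∀ t ∈ T, ∃ a ∈ V, ∃ b ∈ V, (classPos U (E l) L (S, a) + t) / M ≠
      (classPos U (E l) L (S, b) + t) / M) : T.card ≤ N := by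
  classical
  rcases T.eq_empty_or_nonempty with rfl | ⟨t₀, ht₀⟩
  · simp
  obtain ⟨a₀, ha₀, -⟩ := hbad t₀ ht₀
  obtain ⟨a, ha, hamin⟩ := Set.exists_min_image V key hV ⟨a₀, ha₀⟩
  obtain ⟨b, hb, hbmax⟩ := Set.exists_max_image V key hV ⟨a₀, ha₀⟩
  obtain ⟨A, hA, hA'⟩ := exists_class_finset (U := U) (hS.equiv l) (hS.fin l) hL (hVU a ha).1
  have hpos : ∀ c ∈ V, classPos U (E l) L (S, c) = rankIn A key c := fun c hc =>
    (hA' c (hVU c hc).1 (hS.mono k l hkl _ (hVE a ha c hc))).2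
  have hlow : ∀ c ∈ V, rankIn A key a ≤ rankIn A key c := fun c hc =>
    rankIn_le_rankIn (hamin c hc)
  have hupp : ∀ c ∈ V, rankIn A key c ≤ rankIn A key b := fun c hc =>
    rankIn_le_rankIn (hbmax c hc)
  have hne : ∀ t ∈ T, (rankIn A key a + t) / M ≠ (rankIn A key b + t) / M := by
    intro t ht heq
    have hall : ∀ c ∈ V, (rankIn A key c + t) / M = (rankIn A key a + t) / M := fun c hc =>
      le_antisymm ((Nat.div_le_div_right (by have := hupp c hc; omega)).trans heq.ge)
        (Nat.div_le_div_right (by have := hlow c hc; omega))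
    obtain ⟨c, hc, e, he, h⟩ := hbad t ht
    rw [hpos c hc, hpos e he, hall c hc, hall e he] at h
    exact h rfl
  refine (card_filter_div_lt hM (hlow b hb) hT hne).trans ?_
  rw [Nat.sub_le_iff_le_add']
  refine rankIn_le_add.trans (Nat.add_le_add_left (le_trans ?_ (hN a ha)) _)
  rw [← Set.ncard_coe_finset]
  refine Set.ncard_le_ncard ?_ ((hS.fin k a (hVU a ha).1).subset fun z hz => ⟨hz.1, hz.2.2⟩)
  intro z hz
  obtain ⟨hzA, h1, h2⟩ := Finset.mem_filter.1 (Finset.mem_coe.1 hz)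
  obtain ⟨hzS, hzU, -⟩ := (hA z).1 hzA
  exact ⟨hzS, hzU, hconv a (hVU a ha).1 b (hVU b hb).1 z hzS (hVE a ha b hb) h1 h2.le⟩

/-- Two points are related if their representatives lie in the same block. -/
def LiftBlocks (ι : Config d × Eucl d → ℝ) (D : Config d × Eucl d × Eucl d → Prop)
    (E : ℕ → Config d × Eucl d × Eucl d → Prop) (L : Config d × Eucl d × Eucl d → Prop)
    (M t q : ℕ) : Config d × Eucl d × Eucl d → Prop := fun p =>
  ∃ a ∈ p.1.points, ∃ b ∈ p.1.points, IsRep ι D (p.1, a) ∧ IsRep ι D (p.1, b) ∧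
    D (p.1, p.2.1, a) ∧ D (p.1, p.2.2, b) ∧ Blocks (IsRep ι D) E L M t q (p.1, a, b)

theorem adm_liftBlocks {L : Config d × Eucl d × Eucl d → Prop} {M t q : ℕ} (hι : Adm d ι)
    (hD : Adm d D) (hE : ∀ k, Adm d (E k)) (hL : Adm d L) :
    Adm d (LiftBlocks ι D E L M t q) := by
  have h1 := adm_isRep hι hD
  have h2 := adm_blocks (M := M) (t := t) (q := q) h1 hE hL
  unfold LiftBlocks
  fun_prop

theorem eqParts_liftBlocks {L : Config d × Eucl d × Eucl d → Prop} {M t q q' w : ℕ}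
    {Λ : Type*} [LinearOrder Λ] {key : Eucl d → Λ} (hS : Generic ι E S)
    (hL : ∀ x ∈ S.points, ∀ y ∈ S.points, L (S, x, y) ↔ key x < key y)
    (hkey : Set.InjOn key S.points) (hq : 0 < q)
    (hD : EqParts S.points (fun x y => D (S, x, y)) q)
    (hcov : ∀ x ∈ S.points, ¬ ∀ k, Leftover (IsRep ι D) E L M t k (S, x))
    (hq' : 0 < q') (hw : 0 < w) (hM : M = q' * w) :
    EqParts S.points (fun x y => LiftBlocks ι D E L M t q' (S, x, y)) (q' * q) := by
  have h := hD.lift hq (R := {a | IsRep ι D (S, a)}) (fun a ha => ha.1)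
    (fun x hx => isRep_exists hq hD hx) (isRep_unique hS.inj hD)
    (eqParts_blocks hS.equiv hS.fin hL hkey (fun x hx => hx.1) hcov hq' hw hM) hq'
  convert h using 4 with x y
  constructor
  · rintro ⟨a, -, b, -, ha, hb, h⟩
    exact ⟨a, ha, b, hb, h⟩
  · rintro ⟨a, ha, b, hb, h⟩
    exact ⟨a, ha.1, b, hb.1, ha, hb, h⟩

theorem exists_pow_two_div_le (N : ℕ) {ε : ℝ≥0∞} (hε : 0 < ε) :
    ∃ m : ℕ, 1 ≤ m ∧ (N : ℝ≥0∞) / (2 ^ m : ℕ) ≤ ε := by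
  obtain ⟨n, hn⟩ := ENNReal.exists_nat_mul_gt hε.ne' (ENNReal.natCast_ne_top N)
  refine ⟨n + 1, by omega, ENNReal.div_le_of_le_mul (hn.le.trans ?_)⟩
  rw [mul_comm]
  gcongr
  exact Nat.lt_two_pow_self.le.trans (Nat.pow_le_pow_right (by norm_num) (Nat.le_succ n))

theorem exists_extension (hd : 1 ≤ d) (hinv : IsometryInvariant μ) (hι : Adm d ι)
    (hE : ∀ k, Adm d (E k)) (hgen : ∀ᵐ S ∂μ, Generic ι E S) {q : ℕ} (hq : 0 < q) (hD : Adm d D)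
    (hDq : ∀ᵐ S ∂μ, EqParts S.points (fun x y => D (S, x, y)) q) (r : ℝ) {ε : ℝ≥0∞}
    (hε : 0 < ε) :
    ∃ m ≥ 1, ∃ D' : ℕ → Config d × Eucl d × Eucl d → Prop, (∀ j, Adm d (D' j)) ∧
      (∀ᵐ S ∂μ, ∀ j ≤ m, EqParts S.points (fun x y => D' j (S, x, y)) (2 ^ j * q)) ∧
      (∀ᵐ S ∂μ, ∀ x ∈ S.points, ∀ y ∈ S.points, D (S, x, y) → D' 0 (S, x, y)) ∧
      (∀ j p, D' j p → D' (j + 1) p) ∧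
      μ {S | ¬ ∀ x ∈ S.points, ∀ y ∈ S.points, dist x 0 ≤ r → dist y 0 ≤ r →
        D' m (S, x, y)} ≤ ε := by
  -- Four events may fail: common class, bounded class size, distance from the ends, and the shift.
  have hε4 : 0 < ε / 4 := ENNReal.div_pos hε.ne' (by norm_num)
  have hU := adm_isRep hι hD
  have hR := adm_repNear hι hD r
  -- Events about the origin are measurable as sections at `0` of admissible predicates.
  have hsec : ∀ {P : Config d × Eucl d → Prop}, Adm d P → Measurable fun S => P (S, 0) :=
    fun h => h.meas.comp measurable_prodMk_right
  -- the representatives near the origin lie in one class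
  obtain ⟨k₁, -, hk₁⟩ := exists_measure_not_le μ
    (p := fun k S => ∀ a ∈ S.points, ∀ b ∈ S.points, RepNear ι D r (S, 0, a) →
      RepNear ι D r (S, 0, b) → E k (S, a, b))
    (fun k => hsec (P := fun q => ∀ a ∈ q.1.points, ∀ b ∈ q.1.points,
      RepNear ι D r (q.1, q.2, a) → RepNear ι D r (q.1, q.2, b) → E k (q.1, a, b)) (by
        have := hE k
        fun_prop))
    (by
      filter_upwards [hgen, hDq] with S hS hDS
      filter_upwards [eventually_common_class hS.mono hS.conn
        (finite_repNear (ι := ι) hq hDS 0 r) fun a ha => ha.1.1] with k hk a _ b _ ha hb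
      exact hk a ha b hb) hε4 0
  -- this class is not too large
  obtain ⟨N, -, hN⟩ := exists_measure_not_le μ
    (p := fun N S => ∀ a ∈ S.points, RepNear ι D r (S, 0, a) →
      classSize (IsRep ι D) (E k₁) (S, a) ≤ N)
    (fun N => hsec (P := fun q => ∀ a ∈ q.1.points, RepNear ι D r (q.1, q.2, a) →
      classSize (IsRep ι D) (E k₁) (q.1, a) ≤ N) (by
        have := adm_classSize hU (hE k₁)
        fun_prop))
    (by
      filter_upwards [hDq] with S hDS
      have := (Filter.eventually_all_finite (finite_repNear (ι := ι) hq hDS 0 r)).2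
        fun a _ => Filter.eventually_ge_atTop (classSize (IsRep ι D) (E k₁) (S, a))
      filter_upwards [this] with N hN a _ ha
      exact hN a ha) hε4 0
  -- At most `N` of the `2 ^ m` shifts will be bad.
  obtain ⟨m, hm1, hm⟩ := exists_pow_two_div_le N hε4
  have hMpos : 0 < 2 ^ m := by positivity
  -- The order is fixed by `E k₁` once and for all, although coarser classes are cut: this keeps the
  -- representatives near the origin close together in every later list.
  have hL := adm_before hι (hE k₁)
  have htri : ∀ᵐ S ∂μ, ∀ x ∈ S.points, ∀ y ∈ S.points,
      x = y ∨ Before ι (E k₁) (S, x, y) ∨ Before ι (E k₁) (S, y, x) := by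
    filter_upwards [hgen] with S hS x hx y hy
    obtain ⟨key, hkey, hbef, -⟩ := exists_key hS.inj (hS.equiv k₁) (hS.fin k₁)
    rw [hbef x hx y hy, hbef y hy x hx]
    rcases lt_trichotomy (key x) (key y) with h | h | h
    · exact Or.inr (Or.inl h)
    · exact Or.inl (hkey hx hy h)
    · exact Or.inr (Or.inr h)
  have hmax := ae_no_extremal hd hinv hU hL htri
  have hmin := ae_no_extremal (L := fun p => Before ι (E k₁) (p.1, p.2.2, p.2.1)) hd hinv hU
    (by fun_prop) (by
      filter_upwards [htri] with S hS x hx y hy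
      exact (hS x hx y hy).imp_right Or.symm)
  -- the representatives near the origin are far from the ends of their class
  obtain ⟨k₂, hk₂, hdeep⟩ := exists_measure_not_le μ
    (p := fun k S => ∀ a ∈ S.points, RepNear ι D r (S, 0, a) →
      2 ^ m ≤ classPos (IsRep ι D) (E k) (Before ι (E k₁)) (S, a) ∧
      classPos (IsRep ι D) (E k) (Before ι (E k₁)) (S, a) + 2 ^ m ≤
        classSize (IsRep ι D) (E k) (S, a))
    (fun k => hsec (P := fun q => ∀ a ∈ q.1.points, RepNear ι D r (q.1, q.2, a) →
      2 ^ m ≤ classPos (IsRep ι D) (E k) (Before ι (E k₁)) (q.1, a) ∧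
      classPos (IsRep ι D) (E k) (Before ι (E k₁)) (q.1, a) + 2 ^ m ≤
        classSize (IsRep ι D) (E k) (q.1, a)) (by
        have h1 := adm_classSize hU (hE k)
        have h2 := adm_classPos hU (hE k) hL
        fun_prop))
    (by
      filter_upwards [hgen, hDq, hmax, hmin] with S hS hDS hmax hmin
      obtain ⟨key, hkey, hbef, -⟩ := exists_key hS.inj (hS.equiv k₁) (hS.fin k₁)
      have := (Filter.eventually_all_finite (finite_repNear (ι := ι) hq hDS 0 r)).2
        fun a ha => eventually_deep hS hbef hmax hmin (2 ^ m) ha.1.1 ha.1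
      filter_upwards [this] with k hk a _ ha
      exact hk a ha) hε4 k₁
  -- a shift for which the representatives near the origin lie in one block
  obtain ⟨t, -, ht⟩ := exists_measure_le_div μ (K := 2 ^ m) (A := fun t S =>
      (∀ a ∈ S.points, ∀ b ∈ S.points, RepNear ι D r (S, 0, a) →
        RepNear ι D r (S, 0, b) → E k₁ (S, a, b)) ∧
      (∀ a ∈ S.points, RepNear ι D r (S, 0, a) →
        classSize (IsRep ι D) (E k₁) (S, a) ≤ N) ∧
      ∃ a ∈ S.points, ∃ b ∈ S.points, RepNear ι D r (S, 0, a) ∧ RepNear ι D r (S, 0, b) ∧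
        ¬ (classPos (IsRep ι D) (E k₂) (Before ι (E k₁)) (S, a) + t) / 2 ^ m =
          (classPos (IsRep ι D) (E k₂) (Before ι (E k₁)) (S, b) + t) / 2 ^ m)
    (fun t => hsec (P := fun q =>
      (∀ a ∈ q.1.points, ∀ b ∈ q.1.points, RepNear ι D r (q.1, q.2, a) →
        RepNear ι D r (q.1, q.2, b) → E k₁ (q.1, a, b)) ∧
      (∀ a ∈ q.1.points, RepNear ι D r (q.1, q.2, a) →
        classSize (IsRep ι D) (E k₁) (q.1, a) ≤ N) ∧
      ∃ a ∈ q.1.points, ∃ b ∈ q.1.points, RepNear ι D r (q.1, q.2, a) ∧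
        RepNear ι D r (q.1, q.2, b) ∧
        ¬ (classPos (IsRep ι D) (E k₂) (Before ι (E k₁)) (q.1, a) + t) / 2 ^ m =
          (classPos (IsRep ι D) (E k₂) (Before ι (E k₁)) (q.1, b) + t) / 2 ^ m) (by
        have h1 := adm_classSize hU (hE k₁)
        have h2 := adm_classPos hU (hE k₂) hL
        have h3 := hE k₁
        fun_prop))
    hMpos N (by
      filter_upwards [hgen, hDq] with S hS hDS T hT hbad
      rcases T.eq_empty_or_nonempty with rfl | ⟨t₀, ht₀⟩
      · simp
      obtain ⟨key, hkey, hbef, hconv⟩ := exists_key hS.inj (hS.equiv k₁) (hS.fin k₁)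
      obtain ⟨h1, h2, -⟩ := hbad t₀ ht₀
      refine card_bad_shift_le (V := {a | RepNear ι D r (S, 0, a)}) (U := IsRep ι D) hS hbef hk₂
        hconv (finite_repNear hq hDS 0 r) (fun a ha => ⟨ha.1.1, ha.1⟩)
        (fun a ha b hb => h1 a ha.1.1 b hb.1.1 ha hb) (fun a ha => h2 a ha.1.1 ha) hMpos hT ?_
      intro t htT
      obtain ⟨-, -, a, -, b, -, ha, hb, hab⟩ := hbad t htT
      exact ⟨a, ha, b, hb, hab⟩)
  -- The cutting starts at `E k₂`; the never-used representatives form a finite equivariant set,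
  -- hence an empty one.
  have hcov : ∀ᵐ S ∂μ, ∀ x ∈ S.points, ¬ ∀ k, Leftover (IsRep ι D) (fun k => E (k₂ + k))
      (Before ι (E k₁)) (2 ^ m) t k (S, x) := by
    have hadm : Adm d fun p : Config d × Eucl d => ∀ k, Leftover (IsRep ι D)
        (fun k => E (k₂ + k)) (Before ι (E k₁)) (2 ^ m) t k p :=
      Adm.all fun k => adm_leftover hU (fun k => hE _) hL k
    filter_upwards [hgen, ae_infinite_of_nonempty hd hinv hadm] with S hS hinf
    obtain ⟨key, hkey, hbef, -⟩ := exists_key hS.inj (hS.equiv k₁) (hS.fin k₁)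
    have hS' := hS.shift k₂
    exact hinf (finite_leftover hS'.equiv hS'.mono hS'.fin hS'.conn hbef hkey hMpos)
  have hparts : ∀ᵐ S ∂μ, ∀ j ≤ m, EqParts S.points (fun x y => LiftBlocks ι D
      (fun k => E (k₂ + k)) (Before ι (E k₁)) (2 ^ m) t (2 ^ j) (S, x, y)) (2 ^ j * q) := by
    filter_upwards [hgen, hDq, hcov] with S hS hDS hcov j hj
    obtain ⟨key, hkey, hbef, -⟩ := exists_key hS.inj (hS.equiv k₁) (hS.fin k₁)
    exact eqParts_liftBlocks (hS.shift k₂) hbef hkey hq hDS hcov (by positivity)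
      (w := 2 ^ (m - j)) (by positivity) (by rw [← pow_add, Nat.add_sub_cancel' hj])
  refine ⟨m, hm1, fun j => LiftBlocks ι D (fun k => E (k₂ + k)) (Before ι (E k₁)) (2 ^ m) t (2 ^ j),
    fun j => adm_liftBlocks hι hD (fun k => hE _) hL, hparts, ?_, ?_, ?_⟩
  · filter_upwards [hDq, hparts] with S hDS hpS x hx y hy hxy
    obtain ⟨a, ha, b, hb, hra, hrb, hxa, hyb, hab⟩ := (hpS 0 (Nat.zero_le m)).refl x hx
    have hya : D (S, y, a) := hDS.trans y hy x hx a ha (hDS.symm x hx y hy hxy) hxa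
    have hyb' : D (S, y, b) := hDS.trans y hy x hx b hb (hDS.symm x hx y hy hxy) hyb
    exact ⟨a, ha, b, hb, hra, hrb, hxa, hyb', hab⟩
  · rintro j p ⟨a, ha, b, hb, hra, hrb, hxa, hyb, hab⟩
    exact ⟨a, ha, b, hb, hra, hrb, hxa, hyb, hab.mono (pow_dvd_pow 2 (Nat.le_succ j))⟩
  · have hsum : ε / 4 + ε / 4 + (ε / 4 + ε / 4) ≤ ε := by
      rw [← ENNReal.add_div, ← ENNReal.add_div]
      refine ENNReal.div_le_of_le_mul (le_of_eq ?_)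
      ring
    refine (measure_mono_ae ?_).trans ((measure_union_le _ _).trans ((add_le_add
      (measure_union_le _ _) (measure_union_le _ _)).trans ((add_le_add (add_le_add hk₁ hN)
      (add_le_add hdeep (ht.trans hm))).trans hsum)))
    filter_upwards [hgen, hDq] with S hS hDS
    refine (Set.mem_union S _ _).2.comp ?_
    intro hbad
    by_contra hgood
    simp only [Set.mem_union, Set.mem_ofPred_eq, not_or, not_not] at hgood hbad
    obtain ⟨⟨h1, h2⟩, h3, h4⟩ := hgood
    refine hbad fun x hx y hy hxr hyr => ?_
    obtain ⟨a, ha, hxa⟩ := isRep_exists (ι := ι) hq hDS hx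
    obtain ⟨b, hb, hyb⟩ := isRep_exists (ι := ι) hq hDS hy
    have hRa : RepNear ι D r (S, 0, a) := ⟨ha, x, hx, hxr, hxa⟩
    have hRb : RepNear ι D r (S, 0, b) := ⟨hb, y, hy, hyr, hyb⟩
    have hblock : (classPos (IsRep ι D) (E k₂) (Before ι (E k₁)) (S, a) + t) / 2 ^ m =
        (classPos (IsRep ι D) (E k₂) (Before ι (E k₁)) (S, b) + t) / 2 ^ m := by
      by_contra hne
      exact h4 ⟨h1, h2, a, ha.1, b, hb.1, hRa, hRb, hne⟩
    obtain ⟨h5, h6⟩ := h3 a ha.1 hRa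
    -- At step `0` nothing has been removed yet, so the estimates for `E k₂` apply to all
    -- representatives.
    exact ⟨a, ha.1, b, hb.1, ha, hb, hxa, hyb, 0, ha, hb,
      hS.mono k₁ k₂ hk₂ _ (h1 a ha.1 b hb.1 hRa hRb), fullBlock_of_le hMpos h5 h6, hblock⟩

end Extension

/-! ### The clumping -/

section Tower

variable {d : ℕ}

/-- An increasing sequence of relations such that almost surely the classes of the `j`-th one have
`2 ^ j` points, up to level `i`. -/
structure IsTower (μ : Measure (Config d)) (i : ℕ)
    (r : ℕ → Config d × Eucl d × Eucl d → Prop) : Prop where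
  adm : ∀ j, Adm d (r j)
  parts : ∀ᵐ S ∂μ, ∀ j ≤ i, EqParts S.points (fun x y => r j (S, x, y)) (2 ^ j)
  mono : ∀ᵐ S ∂μ, ∀ j < i, ∀ x ∈ S.points, ∀ y ∈ S.points, r j (S, x, y) → r (j + 1) (S, x, y)

variable {μ : Measure (Config d)}

theorem isTower_zero : IsTower μ 0 fun _ p => p.2.1 = p.2.2 where
  adm j := by fun_prop
  parts := by
    refine Filter.Eventually.of_forall fun S j hj => ⟨fun _ _ => rfl, fun _ _ _ _ h => h.symm,
      fun _ _ _ _ _ _ h h' => h.trans h', fun x hx => ?_⟩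
    obtain rfl : j = 0 := by omega
    rw [pow_zero, Set.ncard_eq_one]
    refine ⟨x, ?_⟩
    ext y
    constructor
    · exact fun h => h.2.symm
    · rintro rfl
      exact ⟨hx, rfl⟩
  mono := Filter.Eventually.of_forall fun S j hj => absurd hj (Nat.not_lt_zero j)

variable [IsProbabilityMeasure μ] {ι : Config d × Eucl d → ℝ}
  {E : ℕ → Config d × Eucl d × Eucl d → Prop}

/-- Old levels are kept unchanged; the inclusion of `D` in level `0` of the extension glues level
`i` to level `i + 1`. -/
theorem IsTower.extend (hd : 1 ≤ d) (hinv : IsometryInvariant μ) (hι : Adm d ι)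
    (hE : ∀ k, Adm d (E k)) (hgen : ∀ᵐ S ∂μ, Generic ι E S) {i : ℕ}
    {r : ℕ → Config d × Eucl d × Eucl d → Prop} (h : IsTower μ i r) (R : ℝ) {ε : ℝ≥0∞}
    (hε : 0 < ε) :
    ∃ i' > i, ∃ r', IsTower μ i' r' ∧ (∀ j ≤ i, r' j = r j) ∧
      μ {S | ¬ ∀ x ∈ S.points, ∀ y ∈ S.points, dist x 0 ≤ R → dist y 0 ≤ R →
        r' i' (S, x, y)} ≤ ε := by
  obtain ⟨m, hm, D, hD, hparts, hsub, hmono, hcut⟩ := exists_extension hd hinv hι hE hgen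
    (q := 2 ^ i) (by positivity) (h.adm i)
    (by filter_upwards [h.parts] with S hS using hS i le_rfl) R hε
  refine ⟨i + m, by omega, fun j => if j ≤ i then r j else D (j - i), ⟨fun j => ?_, ?_, ?_⟩,
    fun j hj => if_pos hj, ?_⟩
  · by_cases hj : j ≤ i
    · simpa only [hj, if_true] using h.adm j
    · simpa only [hj, if_false] using hD (j - i)
  · filter_upwards [h.parts, hparts] with S h1 h2 j hj
    by_cases hji : j ≤ i
    · simpa only [hji, if_true] using h1 j hji
    · have := h2 (j - i) (by omega)
      rw [← pow_add, Nat.sub_add_cancel (by omega)] at this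
      simpa only [hji, if_false] using this
  · filter_upwards [h.mono, hsub] with S h1 h2 j hj x hx y hy hxy
    rcases lt_trichotomy j i with hji | rfl | hji
    · simp only [hji.le, if_true] at hxy
      simpa only [Nat.succ_le_of_lt hji, if_true] using h1 j hji x hx y hy hxy
    · simp only [le_refl, if_true] at hxy
      have : D 1 (S, x, y) := hmono 0 _ (h2 x hx y hy hxy)
      simpa using this
    · simp only [hji.not_ge, if_false] at hxy
      have := hmono _ _ hxy
      rw [← Nat.sub_add_comm hji.le] at this
      simpa only [(hji.trans (Nat.lt_succ_self j)).not_ge, if_false] using this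
  · have h1 : ¬ i + m ≤ i := by omega
    simpa only [h1, if_false, Nat.add_sub_cancel_left] using hcut

theorem exists_dyadic (hd : 1 ≤ d) (hinv : IsometryInvariant μ) (hι : Adm d ι)
    (hE : ∀ k, Adm d (E k)) (hgen : ∀ᵐ S ∂μ, Generic ι E S) :
    ∃ r : ℕ → Config d × Eucl d × Eucl d → Prop, (∀ j, Adm d (r j)) ∧
      (∀ᵐ S ∂μ, ∀ j, EqParts S.points (fun x y => r j (S, x, y)) (2 ^ j)) ∧
      (∀ᵐ S ∂μ, ∀ j, ∀ x ∈ S.points, ∀ y ∈ S.points, r j (S, x, y) → r (j + 1) (S, x, y)) ∧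
      ∀ᵐ S ∂μ, ∀ x ∈ S.points, ∀ y ∈ S.points, ∃ j, r j (S, x, y) := by
  let T := {p : ℕ × (ℕ → Config d × Eucl d × Eucl d → Prop) // IsTower μ p.1 p.2}
  have hstep : ∀ (n : ℕ) (p : T), ∃ p' : T, p.1.1 < p'.1.1 ∧ (∀ j ≤ p.1.1, p'.1.2 j = p.1.2 j) ∧
      μ {S | ¬ ∀ x ∈ S.points, ∀ y ∈ S.points, dist x 0 ≤ n → dist y 0 ≤ n →
        p'.1.2 p'.1.1 (S, x, y)} ≤ (2⁻¹ : ℝ≥0∞) ^ n := by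
    rintro n ⟨⟨i, r⟩, h⟩
    obtain ⟨i', hi, r', h', hr, hcut⟩ := h.extend hd hinv hι hE hgen n
      (ENNReal.pow_pos (by simp) n : 0 < (2⁻¹ : ℝ≥0∞) ^ n)
    exact ⟨⟨⟨i', r'⟩, h'⟩, hi, hr, hcut⟩
  choose step hlt hagree hcut using hstep
  let seq : ℕ → T := fun n => Nat.rec ⟨⟨0, _⟩, isTower_zero⟩ step n
  have hseq : ∀ n, seq (n + 1) = step n (seq n) := fun n => rfl
  have hidx : StrictMono fun n => (seq n).1.1 := strictMono_nat_of_lt_succ fun n => by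
    rw [hseq]
    exact hlt n _
  have hle : ∀ m n, m ≤ n → ∀ j ≤ (seq m).1.1, (seq n).1.2 j = (seq m).1.2 j := by
    intro m n hmn j hj
    induction n, hmn using Nat.le_induction with
    | base => rfl
    | succ n hmn ih =>
      rw [hseq, hagree n (seq n) j (hj.trans (hidx.monotone hmn)), ih]
  have heq : ∀ n, ∀ j ≤ (seq n).1.1, (seq j).1.2 j = (seq n).1.2 j := by
    intro n j hj
    rcases le_total j n with h | h
    · exact (hle j n h j (hidx.le_apply)).symm
    · exact hle n j h j hj
  -- Heights increase strictly, so level `j` is settled by stage `j` and never changes afterwards.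
  refine ⟨fun j => (seq j).1.2 j, fun j => (seq j).2.adm j, ?_, ?_, ?_⟩
  · filter_upwards [ae_all_iff.2 fun n => (seq n).2.parts] with S hS j
    exact hS j j hidx.le_apply
  · filter_upwards [ae_all_iff.2 fun n => (seq n).2.mono] with S hS j x hx y hy hxy
    have h1 : j + 1 ≤ (seq (j + 1)).1.1 := hidx.le_apply
    rw [heq (j + 1) j (by omega)] at hxy
    exact hS (j + 1) j h1 x hx y hy hxy
  · have h := ae_eventually_of_measure_not_le μ (by simp [ENNReal.tsum_geometric])
      (fun n => hcut n (seq n))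
    filter_upwards [h] with S hS x hx y hy
    obtain ⟨N, hN⟩ := Filter.eventually_atTop.1 hS
    obtain ⟨n, hn⟩ := exists_nat_ge (max (dist x 0) (dist y 0))
    have h1 : (n : ℝ) ≤ (max N n : ℕ) := by exact_mod_cast le_max_right N n
    have h2 := hN (max N n) (le_max_left _ _) x hx y hy
      (((le_max_left _ _).trans hn).trans h1) (((le_max_right _ _).trans hn).trans h1)
    refine ⟨(seq (max N n + 1)).1.1, ?_⟩
    rw [heq (max N n + 1) _ le_rfl, hseq]
    exact h2

end Tower

/-! ### From almost sure relations to a clumping of every configuration -/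

section Clumping

variable {d : ℕ}

/-- The relations are increasing equivalence relations on the points of the configuration. -/
def IsCoarsening (r : ℕ → Config d × Eucl d × Eucl d → Prop) (S : Config d) : Prop :=
  ∀ j, (∀ x ∈ S.points, ∀ y ∈ S.points, r j (S, x, y) → r j (S, y, x)) ∧
    (∀ x ∈ S.points, ∀ y ∈ S.points, ∀ z ∈ S.points,
      r j (S, x, y) → r j (S, y, z) → r j (S, x, z)) ∧
    ∀ x ∈ S.points, ∀ y ∈ S.points, r j (S, x, y) → r (j + 1) (S, x, y)

variable {r : ℕ → Config d × Eucl d × Eucl d → Prop}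

theorem adm_isCoarsening (hr : ∀ j, Adm d (r j)) : Adm d (IsCoarsening r) := by
  refine Adm.all fun j => ?_
  have h1 := hr j
  have h2 := hr (j + 1)
  fun_prop

/-- The clumping given by a sequence of relations. -/
def Clumping.ofRel (r : ℕ → Config d × Eucl d × Eucl d → Prop) (hr : ∀ j, Adm d (r j)) :
    Clumping d where
  part i S :=
    -- On configurations where the relations misbehave, all clumps are singletons; that exceptional
    -- set is itself measurable and invariant.
    { r := fun x y => x = y ∨ (IsCoarsening r S ∧ r i (S, x, y))
      iseqv := by
        refine ⟨fun _ => Or.inl rfl, ?_, ?_⟩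
        · rintro x y (rfl | ⟨h, hxy⟩)
          · exact Or.inl rfl
          · exact Or.inr ⟨h, (h i).1 x x.2 y y.2 hxy⟩
        · rintro x y z (rfl | ⟨h, hxy⟩) hyz
          · exact hyz
          · rcases hyz with rfl | ⟨-, hyz⟩
            · exact Or.inr ⟨h, hxy⟩
            · exact Or.inr ⟨h, (h i).2.1 x x.2 y y.2 z z.2 hxy hyz⟩ }
  coarser i S x y h := h.imp_right fun h => ⟨h.1, (h.1 i).2.2 x x.2 y y.2 h.2⟩
  equivariant i γ S x y := by
    have h1 : IsCoarsening r (S.map γ) ↔ IsCoarsening r S :=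
      iff_of_eq (((adm_isCoarsening hr).equiv γ S).trans (act_triv _ _))
    have h2 : r i (S.map γ, γ x, γ y) ↔ r i (S, x, y) :=
      iff_of_eq (((hr i).equiv γ (S, (x : Eucl d), (y : Eucl d))).trans (act_triv _ _))
    refine or_congr ?_ (and_congr h1 h2)
    rw [Subtype.ext_iff, Subtype.ext_iff]
    exact γ.injective.eq_iff
  measurable i := by
    have h1 := adm_isCoarsening hr
    have h2 := hr i
    have h : Adm d fun p : Config d × Eucl d × Eucl d => p.2.1 ∈ p.1.points ∧
        p.2.2 ∈ p.1.points ∧ (p.2.1 = p.2.2 ∨ (IsCoarsening r p.1 ∧ r i p)) := by fun_prop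
    convert measurableSet_setOfPred.2 h.meas using 1
    ext p
    constructor
    · rintro ⟨hx, hy, h⟩
      exact ⟨hx, hy, h.imp_left fun h => congrArg Subtype.val h⟩
    · rintro ⟨hx, hy, h⟩
      exact ⟨hx, hy, h.imp_left Subtype.ext⟩

end Clumping

theorem mainTheorem3 (d : ℕ) (hd : 1 ≤ d) (μ : Measure (Config d)) [IsProbabilityMeasure μ]
    (hinv : IsometryInvariant μ) (hint : FiniteIntensity μ) (hidx : AllowsIndexFunction μ) :
    ∃ P : Clumping d, ∀ᵐ S ∂μ,
      P.ConnectedOn S ∧ ∀ i : ℕ, ∀ C ∈ P.clumps i S, C.encard = 2 ^ i := by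
  obtain ⟨ι, hι, hinj⟩ := hidx.exists_adm
  obtain ⟨E, hE, heq, hmono, hfin, hconn⟩ := exists_finite_connected hι hinj
  have hgen : ∀ᵐ S ∂μ, Generic ι E S := by
    filter_upwards [hinj, hfin, hconn] with S h1 h2 h3
    exact ⟨h1, fun k => heq k S, hmono, h2, h3⟩
  obtain ⟨r, hr, hparts, hrmono, hrconn⟩ := exists_dyadic hd hinv hι hE hgen
  refine ⟨Clumping.ofRel r hr, ?_⟩
  filter_upwards [hparts, hrmono, hrconn] with S h1 h2 h3
  have hF : IsCoarsening r S := fun j => ⟨(h1 j).symm, (h1 j).trans, h2 j⟩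
  constructor
  · intro x y
    obtain ⟨j, hj⟩ := h3 x x.2 y y.2
    exact ⟨j, _, ⟨y, rfl⟩, Or.inr ⟨hF, hj⟩, Or.inl rfl⟩
  · rintro i _ ⟨x, rfl⟩
    have himg : Subtype.val '' {y : S.points | (Clumping.ofRel r hr).part i S y x} =
        {y | y ∈ S.points ∧ r i (S, x, y)} := by
      ext y
      constructor
      · rintro ⟨y, (rfl | ⟨-, h⟩), rfl⟩
        · exact ⟨y.2, (h1 i).refl y y.2⟩
        · exact ⟨y.2, (h1 i).symm y y.2 x x.2 h⟩
      · rintro ⟨hy, h⟩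
        exact ⟨⟨y, hy⟩, Or.inr ⟨hF, (h1 i).symm x x.2 y hy h⟩, rfl⟩
    have hfin := (h1 i).finite (by positivity) x.2
    rw [← Subtype.val_injective.encard_image, himg, ← hfin.cast_ncard_eq, (h1 i).card x x.2]
    norm_cast
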